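/- Let $(\Omega,\mathcal F)$ be a measurable space, $\mathcal C\subseteq\mathcal F$ a sub-$\sigma$-algebra, and let $\mathbb F$, $\mathbb C$ be the sets of bounded real functions on $\Omega$ that are $\mathcal F$-measurable, respectively $\mathcal C$-measurable. Let $\rho:\mathbb F\to\mathbb R$ be a sublinear operator: $\rho$ is monotone, $\rho(c)=c$ for constants $c$, $\rho(X+Y)\le\rho(X)+\rho(Y)$, and $\rho(\lambda X)=\lambda\rho(X)$ for $\lambda\ge 0$. Assume that $\rho$ is continuous from above: if $X_n\in\mathbb F$ and $X_n\downarrow 0$ pointwise, then $\rho(X_n)\downarrow 0$. Let $\mathcal P$ be the set of probability measures $P$ on $\mathcal F$ with $E_P[X]\le\rho(X)$ for all $X\in\mathbb F$. Then every linear functional on $\mathbb F$ dominated by $\rho$ is $E_P$ for some $P\in\mathcal P$. Fix $\xi\in\mathbb F$ and put, for $\tilde\eta\in\mathbb C$, $$f(\tilde\eta)=\inf_{\eta\in\mathbb C}\rho[(\xi-\tilde\eta)\eta]\in[-\infty,\infty),\qquad \ker f=\{\tilde\eta\in\mathbb C: f(\tilde\eta)=0\}.$$ 1. $\ker f=\{E_P[\xi|\mathcal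 C]:P\in\mathcal P\}$; that is, $\tilde\eta\in\mathbb C$ lies in $\ker f$ if and only if there is $P\in\mathcal P$ with $\tilde\eta=E_P[\xi|\mathcal C]$ $P$-a.s. 2. There is a probability measure $P_0$ such that every $P\in\mathcal P$ is absolutely continuous with respect to $P_0$ and the set $\mathcal P^e$ of those elements of $\mathcal P$ that are equivalent to $P_0$ is nonempty. Let $P_0$ be any such measure, let $(\mathcal F_n)_{n\ge0}$ be a filtration with $\bigvee_n\mathcal F_n=\mathcal F$, and let $\mathcal C=\mathcal F_\sigma$ for a stopping time $\sigma$ with values in $\{0,1,\dots,\infty\}$ (for instance $\mathcal C=\mathcal F_k$). Assume that $\mathcal P$ is stable: for all $Q^0,Q\in\mathcal P^e$ with density martingales $Z^0_n=E_{P_0}[\frac{dQ^0}{dP_0}|\mathcal F_n]$ and $Z_n=E_{P_0}[\frac{dQ}{dP_0}|\mathcal F_n]$, and for every stopping time $\tau$, the process $L_n=Z^0_n$ for $n\le\tau$, $L_n=Z^0_\tau Z_n/Z_\tau$ for $n\ge\tau$, is the density martingale of an element of $\mathcal P$. Then the essential infimum $\underline\eta=\operatorname{ess\,inf}_{P\in\mathcal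 P}E_P[\xi|\mathcal C]$ and the essential supremum $\overline\eta=\operatorname{ess\,sup}_{P\in\mathcal P}E_P[\xi|\mathcal C]$ exist, that is, the $P_0$-a.s. largest random variable that is $\le E_P[\xi|\mathcal C]$ $P$-a.s. for every $P\in\mathcal P$, and the $P_0$-a.s. smallest one that is $\ge E_P[\xi|\mathcal C]$ $P$-a.s. for every $P\in\mathcal P$. Both can be chosen $\mathcal C$-measurable and real-valued, and (a) every $\tilde\eta\in\mathbb C$ with $\underline\eta\le\tilde\eta\le\overline\eta$ $P_0$-a.s. belongs to $\ker f$; (b) $\ker f=\{\tilde\eta\in\mathbb C:\ \underline\eta\le\tilde\eta\le\overline\eta\ P\text{-a.s. for some }P\in\mathcal P\}$; (c) if every $P\in\mathcal P$ is equivalent to $P_0$ on $\mathcal C$ (so that each $E_P[\xi|\mathcal C]$ is determined up to $P_0$-null sets), then $$\ker f=\{\tilde\eta\in\mathbb C:\ \underline\eta\le\tilde\eta\le\overline\eta\ \ P_0\text{-a.s.}\}.$$ -/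

import Mathlib

open MeasureTheory

/-- The algebra of bounded real functions on `Ω` that are measurable for the σ-algebra `m`. -/
def BddMeas {Ω : Type*} (m : MeasurableSpace Ω) : Subalgebra ℝ (Ω → ℝ) where
  carrier := {X | Measurable[m] X ∧ ∃ M : ℝ, ∀ ω, |X ω| ≤ M}
  mul_mem' := by
    rintro X Y ⟨hX, M, hM⟩ ⟨hY, N, hN⟩
    refine ⟨hX.mul hY, M * N, fun ω => ?_⟩
    rw [Pi.mul_apply, abs_mul]
    exact mul_le_mul (hM ω) (hN ω) (abs_nonneg _) ((abs_nonneg _).trans (hM ω))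
  add_mem' := by
    rintro X Y ⟨hX, M, hM⟩ ⟨hY, N, hN⟩
    exact ⟨hX.add hY, M + N, fun ω => (abs_add_le _ _).trans (add_le_add (hM ω) (hN ω))⟩
  algebraMap_mem' := fun r => ⟨measurable_const, |r|, fun _ => le_rfl⟩

theorem BddMeas.mono {Ω : Type*} {C m : MeasurableSpace Ω} (hC : C ≤ m) :
    BddMeas C ≤ BddMeas m :=
  fun _ hX => ⟨hX.1.mono hC le_rfl, hX.2⟩

/-- Sublinear operators on the bounded measurable functions. -/
structure IsSublinearOperator {Ω : Type*} {m : MeasurableSpace Ω} (ρ : BddMeas m → ℝ) : Prop where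
  monotone : ∀ X Y : BddMeas m, (∀ ω, X.1 ω ≤ Y.1 ω) → ρ X ≤ ρ Y
  const : ∀ c : ℝ, ρ (algebraMap ℝ (BddMeas m) c) = c
  subadd : ∀ X Y : BddMeas m, ρ (X + Y) ≤ ρ X + ρ Y
  pos_homog : ∀ (c : ℝ) (X : BddMeas m), 0 ≤ c → ρ (c • X) = c * ρ X

/-- Continuity from above: `X n ↓ 0` pointwise implies `ρ (X n) → 0` (for a monotone `ρ` the
convergence is then automatically decreasing). -/
def IsContinuousFromAbove {Ω : Type*} {m : MeasurableSpace Ω} (ρ : BddMeas m → ℝ) : Prop :=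
  ∀ X : ℕ → BddMeas m, (∀ ω, Antitone fun n => (X n).1 ω) →
    (∀ ω, Filter.Tendsto (fun n => (X n).1 ω) Filter.atTop (nhds 0)) →
    Filter.Tendsto (fun n => ρ (X n)) Filter.atTop (nhds 0)

/-- The set `𝒫` of the probability measures whose expectation is dominated by `ρ`. -/
def representingSet {Ω : Type*} {m : MeasurableSpace Ω} (ρ : BddMeas m → ℝ) : Set (Measure Ω) :=
  {P | IsProbabilityMeasure P ∧ ∀ X : BddMeas m, ∫ ω, X.1 ω ∂P ≤ ρ X}

/-- `f(η') = inf_η ρ[(ξ - η') η]`, the infimum over all bounded `C`-measurable `η`, as an extended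
real number (it may be `-∞`). -/
noncomputable def projFun {Ω : Type*} {C m : MeasurableSpace Ω} (hC : C ≤ m) (ρ : BddMeas m → ℝ)
    (ξ : BddMeas m) (η' : BddMeas C) : EReal :=
  ⨅ η : BddMeas C,
    ((ρ ((ξ - Subalgebra.inclusion (BddMeas.mono hC) η') *
      Subalgebra.inclusion (BddMeas.mono hC) η) : ℝ) : EReal)

/-- The kernel of `f`. -/
def projKer {Ω : Type*} {C m : MeasurableSpace Ω} (hC : C ≤ m) (ρ : BddMeas m → ℝ)
    (ξ : BddMeas m) : Set (BddMeas C) :=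
  {η' | projFun hC ρ ξ η' = 0}

/-- `P₀` is a reference probability for a set `S` of measures: every element of `S` is absolutely
continuous with respect to `P₀`, and some element of `S` is equivalent to `P₀`. -/
structure IsReferenceMeasure {Ω : Type*} {m : MeasurableSpace Ω} (S : Set (Measure Ω))
    (P₀ : Measure Ω) : Prop where
  isProbabilityMeasure : IsProbabilityMeasure P₀
  dominates : ∀ P ∈ S, P ≪ P₀
  exists_equivalent : ∃ P ∈ S, P₀ ≪ P

/-- The density martingale `Z n = E_{P₀}[dQ/dP₀ | ℱ n]` of `Q`. -/
noncomputable def densityProcess {Ω : Type*} {m : MeasurableSpace Ω} (ℱ : Filtration ℕ m)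
    (P₀ Q : Measure Ω) (n : ℕ) : Ω → ℝ :=
  P₀[fun ω => (Q.rnDeriv P₀ ω).toReal | ℱ n]

open Classical in
/-- The process `L` with `L n = Z⁰ n` for `n ≤ τ` and `L n = Z⁰ τ * Z n / Z τ` for `τ ≤ n`, where
`Z⁰` and `Z` are the density martingales of `Q₀` and `Q`. -/
noncomputable def pastedProcess {Ω : Type*} {m : MeasurableSpace Ω} (ℱ : Filtration ℕ m)
    (P₀ Q₀ Q : Measure Ω) (τ : Ω → WithTop ℕ) (n : ℕ) : Ω → ℝ := fun ω =>
  if (n : WithTop ℕ) ≤ τ ω then densityProcess ℱ P₀ Q₀ n ω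
  else stoppedValue (densityProcess ℱ P₀ Q₀) τ ω *
    (densityProcess ℱ P₀ Q n ω / stoppedValue (densityProcess ℱ P₀ Q) τ ω)

/-- Stability of a set `S` of `P₀`-absolutely continuous probability measures along a filtration:
for `Q₀, Q ∈ S` equivalent to `P₀` and every stopping time, the pasted process is the density
martingale of an element of `S`. -/
def IsStable {Ω : Type*} {m : MeasurableSpace Ω} (ℱ : Filtration ℕ m) (P₀ : Measure Ω)
    (S : Set (Measure Ω)) : Prop :=
  ∀ Q₀ ∈ S, ∀ Q ∈ S, Q₀ ≪ P₀ → P₀ ≪ Q₀ → Q ≪ P₀ → P₀ ≪ Q →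
    ∀ τ : Ω → WithTop ℕ, IsStoppingTime ℱ τ →
      ∃ R ∈ S, R ≪ P₀ ∧ ∀ n, densityProcess ℱ P₀ R n =ᵐ[P₀] pastedProcess ℱ P₀ Q₀ Q τ n

/-- `η` is a version of `ess sup_{P ∈ S} E_P[ξ | C]`: the `P₀`-a.s. smallest random variable that
dominates `E_P[ξ | C]` for all `P ∈ S`. As `E_P[ξ | C]` is determined only up to `P`-null sets,
it is compared `P`-almost surely. -/
structure IsCondEssSup {Ω : Type*} (C : MeasurableSpace Ω) {m : MeasurableSpace Ω}
    (S : Set (Measure Ω)) (P₀ : Measure Ω) (ξ η : Ω → ℝ) : Prop where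
  measurable : Measurable[C] η
  upper : ∀ P ∈ S, P[ξ | C] ≤ᵐ[P] η
  least : ∀ ζ : Ω → ℝ, Measurable[m] ζ → (∀ P ∈ S, P[ξ | C] ≤ᵐ[P] ζ) → η ≤ᵐ[P₀] ζ

/-- `η` is a version of `ess inf_{P ∈ S} E_P[ξ | C]`. -/
structure IsCondEssInf {Ω : Type*} (C : MeasurableSpace Ω) {m : MeasurableSpace Ω}
    (S : Set (Measure Ω)) (P₀ : Measure Ω) (ξ η : Ω → ℝ) : Prop where
  measurable : Measurable[C] η
  lower : ∀ P ∈ S, η ≤ᵐ[P] P[ξ | C]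
  greatest : ∀ ζ : Ω → ℝ, Measurable[m] ζ → (∀ P ∈ S, ζ ≤ᵐ[P] P[ξ | C]) → ζ ≤ᵐ[P₀] η

/-!
A linear functional dominated by `ρ` is positive and normalized, and continuity from above makes it
countably additive on indicators; so it is an expectation
(`exists_mem_representingSet_eq_integral`).

`η'` lies in the kernel exactly when `ρ` is nonnegative on all multiples `(ξ - η') η`. Then the zero
functional on these multiples is dominated by `ρ`, and a Hahn–Banach extension of it is the
expectation under some `P` with `η' = E_P[ξ | C]` (`projKer_eq_condExp`).

Continuity from above makes `𝒫` uniformly countably additive. Hence for each `ε > 0` some `Q ∈ 𝒫`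
has the property that `Q A = 0` implies `P A ≤ ε` for all `P ∈ 𝒫` (`exists_null_imp_real_le`), and a
countable convex combination of such measures dominates `𝒫`.

In the stable case, let `Q₀` and `Q` be equivalent to `P₀` and let `A ∈ C = ℱ_σ`. Pasting along the
stopping time that is `σ` on `A` and `∞` elsewhere gives an element of `𝒫` that agrees with `Q₀` on
`C` and has the `C`-conditional expectations of `Q` on `A` and those of `Q₀` off `A`
(`IsStable.exists_paste`); its density is identified by letting `n → ∞` in the density processes.
Therefore the conditional expectations of `ξ` under equivalent measures are closed under maxima and
minima, and their essential bounds are monotone limits (`exists_isCondEssSup`). By affinity in the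
measure these are also bounds for the elements of `𝒫` that are not equivalent to `P₀`
(`condExp_le_of_forall_equivalent`).

Let `η'` lie `P`-a.s. between the bounds. For every `η`, pasting combines `P` on `C` with conditional
expectations that approach the upper bound on `{η ≥ 0}` and the lower bound on `{η < 0}`, so
`ρ ((ξ - η') η) ≥ 0` (`exists_essInf_essSup_mem_projKer`). The remaining claims follow from this
inclusion.
-/

/-! ### Dominated linear functionals are expectations -/

namespace BddMeas

/-- The indicator function of a measurable set as an element of the algebra `BddMeas m`. -/
noncomputable def ind {Ω : Type*} {m : MeasurableSpace Ω} {A : Set Ω} (hA : MeasurableSet[m] A) :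
    BddMeas m :=
  ⟨A.indicator 1, measurable_one.indicator hA, 1, fun ω => by
    by_cases h : ω ∈ A <;> simp [h]⟩

variable {Ω : Type*} {m : MeasurableSpace Ω}

theorem ind_apply {A : Set Ω} (hA : MeasurableSet[m] A) (ω : Ω) :
    (ind hA).1 ω = A.indicator 1 ω := rfl

theorem ind_mul_add_of_mem {A : Set Ω} (hA : MeasurableSet[m] A) (e₀ e₁ : BddMeas m)
    {ω : Ω} (hω : ω ∈ A) : (ind hA * e₁ + ind hA.compl * e₀).1 ω = e₁.1 ω := by
  change A.indicator 1 ω * e₁.1 ω + Aᶜ.indicator 1 ω * e₀.1 ω = _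
  simp [hω]

theorem ind_mul_add_of_notMem {A : Set Ω} (hA : MeasurableSet[m] A) (e₀ e₁ : BddMeas m)
    {ω : Ω} (hω : ω ∉ A) : (ind hA * e₁ + ind hA.compl * e₀).1 ω = e₀.1 ω := by
  change A.indicator 1 ω * e₁.1 ω + Aᶜ.indicator 1 ω * e₀.1 ω = _
  simp [hω]

theorem exists_bound (X : BddMeas m) : ∃ M : ℝ, 0 ≤ M ∧ ∀ ω, |X.1 ω| ≤ M := by
  obtain ⟨M, hM⟩ := X.2.2
  exact ⟨max M 0, le_max_right _ _, fun ω => (hM ω).trans (le_max_left _ _)⟩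

theorem integrable (X : BddMeas m) (P : Measure Ω) [IsFiniteMeasure P] : Integrable X.1 P := by
  obtain ⟨M, -, hM⟩ := BddMeas.exists_bound X
  exact Integrable.of_bound X.2.1.aestronglyMeasurable M (.of_forall hM)

theorem integral_ind {A : Set Ω} (hA : MeasurableSet[m] A) (P : Measure Ω) :
    ∫ ω, (ind hA).1 ω ∂P = P.real A :=
  integral_indicator_one hA

end BddMeas

open BddMeas Filter Topology

section Sublinear

variable {Ω : Type*} {m : MeasurableSpace Ω} {ρ : BddMeas m → ℝ}

theorem IsSublinearOperator.map_zero (hρ : IsSublinearOperator ρ) : ρ 0 = 0 := by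
  simpa using hρ.const 0

theorem IsSublinearOperator.le_of_forall_le (hρ : IsSublinearOperator ρ) {X : BddMeas m} {c : ℝ}
    (h : ∀ ω, X.1 ω ≤ c) : ρ X ≤ c :=
  (hρ.monotone X (algebraMap ℝ _ c) h).trans_eq (hρ.const c)

theorem map_nonneg_of_le_sublinear (hρ : IsSublinearOperator ρ) {E : BddMeas m →ₗ[ℝ] ℝ}
    (hE : ∀ X, E X ≤ ρ X) {X : BddMeas m} (hX : ∀ ω, 0 ≤ X.1 ω) : 0 ≤ E X := by
  have h := (hE (-X)).trans (hρ.le_of_forall_le (c := 0) fun ω => neg_nonpos.2 (hX ω))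
  rw [map_neg] at h
  linarith

theorem map_one_of_le_sublinear (hρ : IsSublinearOperator ρ) {E : BddMeas m →ₗ[ℝ] ℝ}
    (hE : ∀ X, E X ≤ ρ X) : E 1 = 1 := by
  refine le_antisymm ((hE 1).trans (hρ.le_of_forall_le fun ω => le_rfl)) ?_
  have h := (hE (-1)).trans (hρ.le_of_forall_le (c := -1) fun ω => le_rfl)
  rw [map_neg] at h
  linarith

theorem abs_map_le_of_le_sublinear (hρ : IsSublinearOperator ρ) {E : BddMeas m →ₗ[ℝ] ℝ}
    (hE : ∀ X, E X ≤ ρ X) {X : BddMeas m} {c : ℝ} (hX : ∀ ω, |X.1 ω| ≤ c) : |E X| ≤ c := by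
  have h := (hE (-X)).trans (hρ.le_of_forall_le (c := c) fun ω => (neg_le_abs _).trans (hX ω))
  rw [map_neg] at h
  exact abs_le.2 ⟨by linarith,
    (hE X).trans (hρ.le_of_forall_le fun ω => (le_abs_self _).trans (hX ω))⟩

theorem tendsto_ind_of_antitone {A : ℕ → Set Ω} (hA : ∀ n, MeasurableSet[m] (A n))
    (hcont : IsContinuousFromAbove ρ) (hanti : Antitone A) (hinter : ⋂ n, A n = ∅) :
    Tendsto (fun n => ρ (ind (hA n))) atTop (𝓝 0) := by
  refine hcont _ (fun ω i j hij => ?_) fun ω => ?_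
  · exact Set.indicator_le_indicator_of_subset (hanti hij) (fun _ => zero_le_one) ω
  · have h : ω ∉ ⋂ n, A n := by simp [hinter]
    rw [Set.mem_iInter, not_forall] at h
    obtain ⟨n, hn⟩ := h
    refine tendsto_const_nhds.congr' ?_
    filter_upwards [eventually_ge_atTop n] with k hk
    rw [ind_apply, Set.indicator_of_notMem fun h => hn (hanti hk h)]

theorem map_ind_hasSum (hρ : IsSublinearOperator ρ) (hcont : IsContinuousFromAbove ρ)
    {E : BddMeas m →ₗ[ℝ] ℝ} (hE : ∀ X, E X ≤ ρ X) {A : ℕ → Set Ω}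
    (hA : ∀ n, MeasurableSet[m] (A n)) (hd : Pairwise (Function.onFun Disjoint A)) :
    HasSum (fun n => E (ind (hA n))) (E (ind (MeasurableSet.iUnion hA))) := by
  have hpos : ∀ {B : Set Ω} (hB : MeasurableSet[m] B), 0 ≤ E (ind hB) := fun {B} hB =>
    map_nonneg_of_le_sublinear hρ hE fun ω => Set.indicator_nonneg (fun _ _ => zero_le_one) ω
  rw [hasSum_iff_tendsto_nat_of_nonneg fun n => hpos _]
  have hB : ∀ n, MeasurableSet[m] (⋃ k, A (n + k)) := fun n => MeasurableSet.iUnion fun k => hA _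
  have hlim := tendsto_ind_of_antitone hB hcont
    (fun i j hij ω hω => by
      obtain ⟨k, hk⟩ := Set.mem_iUnion.1 hω
      exact Set.mem_iUnion.2 ⟨j - i + k, by rwa [← add_assoc, Nat.add_sub_cancel' hij]⟩)
    (by
      refine Set.eq_empty_of_forall_notMem fun ω hω => ?_
      rw [Set.mem_iInter] at hω
      obtain ⟨k, hk⟩ := Set.mem_iUnion.1 (hω 0)
      obtain ⟨l, hl⟩ := Set.mem_iUnion.1 (hω (0 + k + 1))
      exact Set.disjoint_left.1 (hd (show 0 + k ≠ 0 + k + 1 + l by omega)) hk hl)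
  have hsplit : ∀ n, ind (MeasurableSet.iUnion hA) =
      ∑ i ∈ Finset.range n, ind (hA i) + ind (hB n) := by
    intro n
    induction n with
    | zero =>
      refine Subtype.ext (funext fun ω => ?_)
      simp only [Finset.range_zero, Finset.sum_empty, zero_add]
    | succ n ih =>
      rw [ih, Finset.sum_range_succ, add_assoc]
      congr 1
      refine Subtype.ext ?_
      have hU : (⋃ k, A (n + k)) = A n ∪ ⋃ k, A (n + 1 + k) := by
        have h := sup_iSup_nat_succ fun k => A (n + k)
        simp only [add_zero, ← add_assoc, add_right_comm n _ 1] at h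
        exact h.symm
      have hdis : Disjoint (A n) (⋃ k, A (n + 1 + k)) :=
        Set.disjoint_iUnion_right.2 fun k => hd (by omega)
      change (⋃ k, A (n + k)).indicator 1 = (A n).indicator 1 + (⋃ k, A (n + 1 + k)).indicator 1
      rw [hU, Set.indicator_union_of_disjoint hdis]
      rfl
  have hE0 : Tendsto (fun n => E (ind (hB n))) atTop (𝓝 0) :=
    tendsto_of_tendsto_of_tendsto_of_le_of_le tendsto_const_nhds hlim (fun n => hpos _)
      fun n => hE _
  have := (tendsto_const_nhds (x := E (ind (MeasurableSet.iUnion hA)))).sub hE0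
  rw [sub_zero] at this
  refine this.congr fun n => ?_
  rw [hsplit n, map_add, map_sum, add_sub_cancel_right]

/-- The Riesz representation: a linear functional dominated by `ρ` is positive and normalized, and
continuity from above makes its values on indicators countably additive. The functional and the
expectation agree on simple functions, and rounding down to multiples of `1 / n` approximates every
bounded function uniformly by simple ones. -/
theorem exists_mem_representingSet_eq_integral (hρ : IsSublinearOperator ρ)
    (hcont : IsContinuousFromAbove ρ) (E : BddMeas m →ₗ[ℝ] ℝ) (hE : ∀ X, E X ≤ ρ X) :
    ∃ P ∈ representingSet ρ, ∀ X : BddMeas m, E X = ∫ ω, X.1 ω ∂P := by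
  have hpos : ∀ {B : Set Ω} (hB : MeasurableSet[m] B), 0 ≤ E (ind hB) := fun {B} hB =>
    map_nonneg_of_le_sublinear hρ hE fun ω => Set.indicator_nonneg (fun _ _ => zero_le_one) ω
  have h0 : E (ind (MeasurableSet.empty (α := Ω))) = 0 := by
    have : ind (MeasurableSet.empty (α := Ω)) = 0 := Subtype.ext (Set.indicator_empty _)
    rw [this, map_zero]
  have hU : E (ind (MeasurableSet.univ (α := Ω))) = 1 := by
    rw [← map_one_of_le_sublinear hρ hE]
    exact congrArg E (Subtype.ext (Set.indicator_univ _))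
  let P : Measure Ω := Measure.ofMeasurable (fun A hA => ENNReal.ofReal (E (ind hA)))
    (by rw [h0, ENNReal.ofReal_zero]) fun A hA hd => by
      have h := map_ind_hasSum hρ hcont hE hA hd
      rw [← h.tsum_eq, ENNReal.ofReal_tsum_of_nonneg (fun n => hpos _) h.summable]
  have hPapp : ∀ {A : Set Ω} (hA : MeasurableSet[m] A), P A = ENNReal.ofReal (E (ind hA)) :=
    fun hA => Measure.ofMeasurable_apply _ hA
  have hP : IsProbabilityMeasure P := ⟨by rw [hPapp .univ, hU, ENNReal.ofReal_one]⟩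
  -- the difference `T` of the two functionals vanishes on simple functions
  let I : BddMeas m →ₗ[ℝ] ℝ :=
    { toFun := fun X => ∫ ω, X.1 ω ∂P
      map_add' := fun X Y => integral_add (BddMeas.integrable X P) (BddMeas.integrable Y P)
      map_smul' := fun c X => integral_const_mul c X.1 }
  have hIbound : ∀ {X : BddMeas m} {c : ℝ}, (∀ ω, |X.1 ω| ≤ c) → |I X| ≤ c := fun {X c} hX => by
    have := norm_integral_le_of_norm_le_const (μ := P) (f := X.1) (C := c) (.of_forall hX)
    rwa [measureReal_def, measure_univ, ENNReal.toReal_one, mul_one] at this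
  have hind : ∀ {A : Set Ω} (hA : MeasurableSet[m] A), E (ind hA) = I (ind hA) := fun {A} hA => by
    change E (ind hA) = ∫ ω, (ind hA).1 ω ∂P
    rw [integral_ind, measureReal_def, hPapp hA, ENNReal.toReal_ofReal (hpos hA)]
  have hsimple : ∀ (s : SimpleFunc Ω ℝ) (hs : (s : Ω → ℝ) ∈ BddMeas m),
      E ⟨s, hs⟩ = I ⟨s, hs⟩ := by
    have hmem : ∀ s : SimpleFunc Ω ℝ, (s : Ω → ℝ) ∈ BddMeas m := fun s => by
      obtain ⟨c, hc⟩ := s.exists_forall_norm_le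
      exact ⟨s.measurable, c, hc⟩
    intro s
    induction s using SimpleFunc.induction with
    | const c hA =>
      intro hs
      have : (⟨_, hs⟩ : BddMeas m) = c • ind hA := by
        refine Subtype.ext (funext fun ω => ?_)
        change _ = c * Set.indicator _ 1 ω
        rename_i A
        by_cases h : ω ∈ A <;> simp [h]
      rw [this, map_smul, map_smul, hind]
    | @add f g hd hf hg =>
      intro hs
      have : (⟨_, hs⟩ : BddMeas m) = ⟨f, hmem f⟩ + ⟨g, hmem g⟩ := rfl
      rw [this, map_add, map_add, hf, hg]
  have hEI : ∀ X : BddMeas m, E X = I X := by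
    intro X
    obtain ⟨M, hM0, hM⟩ := BddMeas.exists_bound X
    have key : ∀ n : ℕ, |E X - I X| * n ≤ 2 := by
      intro n
      let s : SimpleFunc Ω ℝ :=
        { toFun := fun ω => ((⌊(n : ℝ) * X.1 ω⌋ : ℤ) : ℝ)
          measurableSet_fiber' := fun x => by
            have h : Measurable fun ω => ((⌊(n : ℝ) * X.1 ω⌋ : ℤ) : ℝ) :=
              (measurable_from_top (f := fun k : ℤ => (k : ℝ))).comp
                (Int.measurable_floor.comp (X.2.1.const_mul (n : ℝ)))
            exact h (measurableSet_singleton x)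
          finite_range' := by
            refine ((Set.finite_Icc ⌊-((n : ℝ) * M)⌋ ⌊(n : ℝ) * M⌋).image
              (fun k : ℤ => (k : ℝ))).subset ?_
            rintro _ ⟨ω, rfl⟩
            have hn : (0 : ℝ) ≤ n := n.cast_nonneg
            refine ⟨_, ⟨Int.floor_mono ?_, Int.floor_mono ?_⟩, rfl⟩
            · rw [← mul_neg]
              exact mul_le_mul_of_nonneg_left (abs_le.1 (hM ω)).1 hn
            · exact mul_le_mul_of_nonneg_left (abs_le.1 (hM ω)).2 hn }
      have hs : (s : Ω → ℝ) ∈ BddMeas m := by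
        obtain ⟨c, hc⟩ := s.exists_forall_norm_le
        exact ⟨s.measurable, c, hc⟩
      let D : BddMeas m := (n : ℝ) • X - ⟨s, hs⟩
      have hD : ∀ ω, |D.1 ω| ≤ 1 := fun ω => by
        change |(n : ℝ) * X.1 ω - (⌊(n : ℝ) * X.1 ω⌋ : ℤ)| ≤ 1
        rw [Int.self_sub_floor, abs_of_nonneg (Int.fract_nonneg _)]
        exact (Int.fract_lt_one _).le
      have h1 := abs_map_le_of_le_sublinear hρ hE hD
      have h2 := hIbound hD
      have h3 : E D - I D = (E X - I X) * n := by
        simp only [D, map_sub, map_smul, hsimple s hs, smul_eq_mul]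
        ring
      calc |E X - I X| * n = |E D - I D| := by rw [h3, abs_mul, Nat.abs_cast]
        _ ≤ |E D| + |I D| := abs_sub _ _
        _ ≤ 2 := by linarith
    by_contra hne
    have hpos' : 0 < |E X - I X| := abs_pos.2 (sub_ne_zero.2 hne)
    obtain ⟨n, hn⟩ := exists_nat_gt (2 / |E X - I X|)
    rw [div_lt_iff₀ hpos', mul_comm] at hn
    exact absurd (key n) (not_le.2 hn)
  exact ⟨P, ⟨hP, fun X => (hEI X).symm.trans_le (hE X)⟩, hEI⟩

end Sublinear

/-! ### The kernel of the projection -/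

section Kernel

variable {Ω : Type*} {C m : MeasurableSpace Ω} {ρ : BddMeas m → ℝ}

theorem mem_projKer_iff (hC : C ≤ m) (hρ : IsSublinearOperator ρ) (ξ : BddMeas m)
    (η' : BddMeas C) :
    η' ∈ projKer hC ρ ξ ↔ ∀ η : BddMeas C,
      0 ≤ ρ ((ξ - Subalgebra.inclusion (BddMeas.mono hC) η') *
        Subalgebra.inclusion (BddMeas.mono hC) η) := by
  change projFun hC ρ ξ η' = 0 ↔ _
  constructor
  · intro h η
    rw [← EReal.coe_nonneg, ← h]
    exact iInf_le _ η
  · intro h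
    refine le_antisymm ?_ (le_iInf fun η => EReal.coe_nonneg.2 (h η))
    refine (iInf_le _ 0).trans_eq ?_
    rw [_root_.map_zero, mul_zero, hρ.map_zero, EReal.coe_zero]

theorem ae_eq_condExp_of_forall_integral_mul_eq_zero (hC : C ≤ m) (P : Measure Ω)
    [IsProbabilityMeasure P] (ξ : BddMeas m) (η' : BddMeas C)
    (h : ∀ A : Set Ω, MeasurableSet[C] A → ∫ ω, (ξ.1 ω - η'.1 ω) * A.indicator 1 ω ∂P = 0) :
    η'.1 =ᵐ[P] P[ξ.1 | C] := by
  have hη : Integrable η'.1 P := BddMeas.integrable (Subalgebra.inclusion (BddMeas.mono hC) η') P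
  have hξ := BddMeas.integrable ξ P
  refine ae_eq_condExp_of_forall_setIntegral_eq hC hξ (fun s _ _ => hη.integrableOn)
    (fun s hs _ => ?_) η'.2.1.stronglyMeasurable.aestronglyMeasurable
  have h1 := h s hs
  have h2 : ∀ ω, (ξ.1 ω - η'.1 ω) * s.indicator 1 ω = s.indicator (fun ω => ξ.1 ω - η'.1 ω) ω :=
    fun ω => by by_cases hω : ω ∈ s <;> simp [hω]
  simp_rw [h2] at h1
  rw [integral_indicator (hC s hs), integral_sub hξ.integrableOn hη.integrableOn] at h1
  linarith

theorem integral_version_sub_mul (hC : C ≤ m) (P : Measure Ω) [IsProbabilityMeasure P]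
    (ξ : BddMeas m) {v : BddMeas C} (hv : v.1 =ᵐ[P] P[ξ.1 | C]) (η' η : BddMeas C) :
    ∫ ω, ((v - η') * η).1 ω ∂P = ∫ ω, ((ξ - Subalgebra.inclusion (BddMeas.mono hC) η') *
      Subalgebra.inclusion (BddMeas.mono hC) η).1 ω ∂P := by
  set ι := Subalgebra.inclusion (BddMeas.mono hC)
  have h := condExp_mul_of_stronglyMeasurable_right (m := C) (μ := P) (f := ξ.1) (g := η.1)
    η.2.1.stronglyMeasurable (BddMeas.integrable (ξ * ι η) P) (BddMeas.integrable ξ P)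
  have h1 : ∫ ω, (ι v * ι η).1 ω ∂P = ∫ ω, (ξ * ι η).1 ω ∂P := by
    refine Eq.trans (integral_congr_ae ?_) (integral_condExp hC)
    filter_upwards [h, hv] with ω h1 h2
    refine Eq.trans ?_ h1.symm
    change v.1 ω * η.1 ω = _
    rw [h2, Pi.mul_apply]
  have h2 : ∀ X : BddMeas m, ∫ ω, ((X - ι η') * ι η).1 ω ∂P =
      ∫ ω, (X * ι η).1 ω ∂P - ∫ ω, (ι η' * ι η).1 ω ∂P := fun X => by
    rw [← integral_sub (BddMeas.integrable (X * ι η) P) (BddMeas.integrable (ι η' * ι η) P)]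
    exact integral_congr_ae (.of_forall fun ω => sub_mul (X.1 ω) (η'.1 ω) (η.1 ω))
  exact (h2 (ι v)).trans (by rw [h1, h2 ξ])

/-- If `η'` lies in the kernel, the zero functional on the multiples `(ξ - η') η` is dominated by
`ρ`; any dominated extension is the expectation under some `P`, and `η' = E_P[ξ | C]` because
`E_P` vanishes on these multiples. -/
theorem projKer_eq_condExp (hC : C ≤ m) (hρ : IsSublinearOperator ρ)
    (hcont : IsContinuousFromAbove ρ) (ξ : BddMeas m) :
    projKer hC ρ ξ = {η' | ∃ P ∈ representingSet ρ, η'.1 =ᵐ[P] P[ξ.1 | C]} := by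
  ext η'
  rw [mem_projKer_iff hC hρ]
  set ι := Subalgebra.inclusion (BddMeas.mono hC)
  constructor
  · intro h
    let D : Submodule ℝ (BddMeas m) := LinearMap.range
      ((LinearMap.mulLeft ℝ (ξ - ι η')).comp ι.toLinearMap)
    obtain ⟨E, hE0, hE⟩ := exists_extension_of_le_sublinear (⟨D, 0⟩ : BddMeas m →ₗ.[ℝ] ℝ) ρ
      (fun c hc X => hρ.pos_homog c X hc.le) hρ.subadd (by
        rintro ⟨_, η, rfl⟩
        exact h η)
    obtain ⟨P, hP, hEP⟩ := exists_mem_representingSet_eq_integral hρ hcont E hE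
    have := hP.1
    refine ⟨P, hP, ae_eq_condExp_of_forall_integral_mul_eq_zero hC P ξ η' fun A hA => ?_⟩
    have h1 := hE0 ⟨(ξ - ι η') * ι (ind hA), ⟨ind hA, rfl⟩⟩
    rw [hEP] at h1
    exact h1
  · rintro ⟨P, hP, hη⟩ η
    have := hP.1
    refine le_trans (le_of_eq ?_) (hP.2 _)
    rw [← integral_version_sub_mul hC P ξ hη η' η, sub_self, zero_mul]
    exact integral_zero Ω ℝ |>.symm

end Kernel

/-! ### Convex combinations and the reference measure -/

section Reference

variable {Ω : Type*} {m : MeasurableSpace Ω} {ρ : BddMeas m → ℝ}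

theorem representingSet_nonempty (hρ : IsSublinearOperator ρ) (hcont : IsContinuousFromAbove ρ) :
    (representingSet ρ).Nonempty := by
  obtain ⟨E, -, hE⟩ := exists_extension_of_le_sublinear (⟨⊥, 0⟩ : BddMeas m →ₗ.[ℝ] ℝ) ρ
    (fun c hc X => hρ.pos_homog c X hc.le) hρ.subadd (by
      rintro ⟨x, hx⟩
      obtain rfl : x = 0 := (Submodule.mem_bot ℝ).1 hx
      exact hρ.map_zero.ge)
  obtain ⟨P, hP, -⟩ := exists_mem_representingSet_eq_integral hρ hcont E hE
  exact ⟨P, hP⟩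

theorem real_le_of_mem_representingSet {P : Measure Ω} (hP : P ∈ representingSet ρ) {A : Set Ω}
    (hA : MeasurableSet[m] A) : P.real A ≤ ρ (ind hA) :=
  (integral_ind hA P).symm.trans_le (hP.2 _)

/-- The convex combination `(1 - ε) P + ε Q` of two measures. -/
noncomputable def mixMeasure (ε : ℝ) (P Q : Measure Ω) : Measure Ω :=
  ENNReal.ofReal (1 - ε) • P + ENNReal.ofReal ε • Q

theorem integral_mixMeasure {ε : ℝ} (h0 : 0 ≤ ε) (h1 : ε ≤ 1) {P Q : Measure Ω} {X : Ω → ℝ}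
    (hP : Integrable X P) (hQ : Integrable X Q) :
    ∫ ω, X ω ∂(mixMeasure ε P Q) = (1 - ε) * ∫ ω, X ω ∂P + ε * ∫ ω, X ω ∂Q := by
  rw [mixMeasure, integral_add_measure (hP.smul_measure ENNReal.ofReal_ne_top)
    (hQ.smul_measure ENNReal.ofReal_ne_top), integral_smul_measure, integral_smul_measure,
    ENNReal.toReal_ofReal (sub_nonneg.2 h1), ENNReal.toReal_ofReal h0, smul_eq_mul, smul_eq_mul]

theorem mixMeasure_mem {ε : ℝ} (h0 : 0 ≤ ε) (h1 : ε ≤ 1) {P Q : Measure Ω}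
    (hP : P ∈ representingSet ρ) (hQ : Q ∈ representingSet ρ) :
    mixMeasure ε P Q ∈ representingSet ρ := by
  have := hP.1
  have := hQ.1
  refine ⟨⟨?_⟩, fun X => ?_⟩
  · simp only [mixMeasure, Measure.coe_add, Measure.coe_smul, Pi.add_apply, Pi.smul_apply,
      measure_univ, smul_eq_mul, mul_one]
    rw [← ENNReal.ofReal_add (sub_nonneg.2 h1) h0, sub_add_cancel, ENNReal.ofReal_one]
  · rw [integral_mixMeasure h0 h1 (BddMeas.integrable X P) (BddMeas.integrable X Q)]
    nlinarith [mul_le_mul_of_nonneg_left (hP.2 X) (sub_nonneg.2 h1),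
      mul_le_mul_of_nonneg_left (hQ.2 X) h0]

theorem absolutelyContinuous_mixMeasure_left {ε : ℝ} (h1 : ε < 1) (P Q : Measure Ω) :
    P ≪ mixMeasure ε P Q :=
  (Measure.absolutelyContinuous_smul
    (by rwa [ne_eq, ENNReal.ofReal_eq_zero, not_le, sub_pos])).trans
    (Measure.le_add_right le_rfl).absolutelyContinuous

theorem absolutelyContinuous_mixMeasure_right {ε : ℝ} (h0 : 0 < ε) (P Q : Measure Ω) :
    Q ≪ mixMeasure ε P Q :=
  (Measure.absolutelyContinuous_smul
    (by rwa [ne_eq, ENNReal.ofReal_eq_zero, not_le])).trans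
    (Measure.le_add_left le_rfl).absolutelyContinuous

theorem exists_mem_representingSet_sum (Q : ℕ → Measure Ω) (hQ : ∀ n, Q n ∈ representingSet ρ) :
    ∃ P ∈ representingSet ρ, ∀ n, Q n ≪ P := by
  have hQp := fun n => (hQ n).1
  let c : ℕ → ENNReal := fun n => ENNReal.ofReal ((1 / 2 : ℝ) / 2 ^ n)
  have hc0 : ∀ n, 0 ≤ (1 / 2 : ℝ) / 2 ^ n := fun n => by positivity
  have hcsum : HasSum (fun n : ℕ => (1 / 2 : ℝ) / 2 ^ n) 1 := hasSum_geometric_two' 1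
  let P := Measure.sum fun n => c n • Q n
  have hP : IsProbabilityMeasure P := ⟨by
    rw [Measure.sum_apply _ .univ]
    simp only [Measure.coe_smul, Pi.smul_apply, measure_univ, smul_eq_mul, mul_one, c]
    rw [← ENNReal.ofReal_tsum_of_nonneg hc0 hcsum.summable, hcsum.tsum_eq, ENNReal.ofReal_one]⟩
  refine ⟨P, ⟨hP, fun X => ?_⟩, fun n => ?_⟩
  · have h := hasSum_integral_measure (BddMeas.integrable X P)
    have h' := hcsum.mul_right (ρ X)
    rw [one_mul] at h'
    refine hasSum_le (fun n => ?_) h h'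
    rw [integral_smul_measure, ENNReal.toReal_ofReal (hc0 n)]
    exact mul_le_mul_of_nonneg_left ((hQ n).2 X) (hc0 n)
  · refine (Measure.absolutelyContinuous_smul ?_).trans
      (Measure.le_sum (fun n => c n • Q n) n).absolutelyContinuous
    rw [ne_eq, ENNReal.ofReal_eq_zero, not_le]
    positivity

/-- Otherwise there are `Q n` increasing in the order `≪`, `A n` with `Q n (A n) = 0`, and elements
`P n ≪ Q (n + 1)` with `P n (A n) > ε`. The upper limit `B` of the `A n` is null for all of them,
and `⋃ k ≥ n, A k \ B` decreases to the empty set, so its probability is small uniformly on the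
representing set. -/
theorem exists_null_imp_real_le (hρ : IsSublinearOperator ρ) (hcont : IsContinuousFromAbove ρ)
    {ε : ℝ} (hε : 0 < ε) :
    ∃ Q ∈ representingSet ρ, ∀ A : Set Ω, MeasurableSet[m] A → Q A = 0 →
      ∀ P ∈ representingSet ρ, P.real A ≤ ε := by
  by_contra! hcon
  obtain ⟨P₀, hP₀⟩ := representingSet_nonempty hρ hcont
  choose A hA hQA P hP hPA using fun Q : representingSet ρ => hcon Q.1 Q.2
  let Q : ℕ → representingSet ρ := Nat.rec ⟨P₀, hP₀⟩ fun _ Q =>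
    ⟨mixMeasure (1 / 2) Q.1 (P Q), mixMeasure_mem (by norm_num) (by norm_num) Q.2 (hP Q)⟩
  have hQmono : ∀ n k, (Q n).1 ≪ (Q (n + k)).1 := fun n k => by
    induction k with
    | zero => exact Measure.AbsolutelyContinuous.rfl
    | succ k ih => exact ih.trans (absolutelyContinuous_mixMeasure_left (by norm_num) _ _)
  have hPQ : ∀ n, P (Q n) ≪ (Q (n + 1)).1 := fun n =>
    absolutelyContinuous_mixMeasure_right (by norm_num) _ _
  let U : ℕ → Set Ω := fun n => ⋃ k, A (Q (n + k))
  let B : Set Ω := ⋂ n, U n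
  have hU : ∀ n, MeasurableSet[m] (U n) := fun n => MeasurableSet.iUnion fun k => hA _
  have hB : MeasurableSet[m] B := MeasurableSet.iInter hU
  have hUanti : Antitone U := fun i j hij ω hω => by
    obtain ⟨k, hk⟩ := Set.mem_iUnion.1 hω
    exact Set.mem_iUnion.2 ⟨j - i + k, by rwa [← add_assoc, Nat.add_sub_cancel' hij]⟩
  have hQB : ∀ n, (Q n).1 B = 0 := fun n =>
    measure_mono_null (Set.iInter_subset U n)
      (measure_iUnion_null fun k => hQmono n k (hQA (Q (n + k))))
  have hlim := tendsto_ind_of_antitone (fun n => (hU n).diff hB) hcont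
    (fun i j hij => Set.sdiff_subset_sdiff_left (hUanti hij))
    (by
      refine Set.eq_empty_of_forall_notMem fun ω hω => ?_
      rw [Set.mem_iInter] at hω
      exact (hω 0).2 (Set.mem_iInter.2 fun n => (hω n).1))
  obtain ⟨n, hn⟩ := (hlim.eventually_lt_const hε).exists
  have := (hP (Q n)).1
  have h1 : (P (Q n)).real (A (Q n)) ≤ (P (Q n)).real (U n \ B) := by
    rw [measureReal_def, measureReal_def,
      measure_sdiff_null (hPQ n (hQB (n + 1)))]
    exact ENNReal.toReal_mono (measure_ne_top _ _)
      (measure_mono (Set.subset_iUnion (fun k => A (Q (n + k))) 0))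
  have h2 := real_le_of_mem_representingSet (hP (Q n)) ((hU n).diff hB)
  linarith [hPA (Q n)]

theorem exists_isReferenceMeasure (hρ : IsSublinearOperator ρ) (hcont : IsContinuousFromAbove ρ) :
    ∃ P₀ : Measure Ω, IsReferenceMeasure (representingSet ρ) P₀ := by
  choose Q hQ hnull using fun n : ℕ =>
    exists_null_imp_real_le hρ hcont (Nat.one_div_pos_of_nat (α := ℝ) (n := n))
  obtain ⟨P₀, hP₀, hQP⟩ := exists_mem_representingSet_sum Q hQ
  refine ⟨P₀, hP₀.1, fun P hP => ?_, P₀, hP₀, Measure.AbsolutelyContinuous.rfl⟩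
  have := hP.1
  refine Measure.AbsolutelyContinuous.mk fun A hA h0 => ?_
  have h : P.real A ≤ 0 := ge_of_tendsto' tendsto_one_div_add_atTop_nhds_zero_nat
    fun n => hnull n A hA (hQP n h0) P hP
  exact (measureReal_eq_zero_iff (measure_ne_top _ _)).1 (h.antisymm measureReal_nonneg)

end Reference

/-! ### Density processes -/

section Density

variable {Ω : Type*} {m : MeasurableSpace Ω} {P₀ Q : Measure Ω}

theorem densityProcess_stronglyAdapted (ℱ : Filtration ℕ m) (P₀ Q : Measure Ω) :
    StronglyAdapted ℱ (densityProcess ℱ P₀ Q) :=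
  fun _ => stronglyMeasurable_condExp

theorem tendsto_densityProcess [IsProbabilityMeasure P₀] (ℱ : Filtration ℕ m)
    (hℱ : ⨆ n, ℱ n = m) (Q : Measure Ω) [IsProbabilityMeasure Q] :
    ∀ᵐ ω ∂P₀, Tendsto (fun n => densityProcess ℱ P₀ Q n ω) atTop
      (𝓝 (Q.rnDeriv P₀ ω).toReal) := by
  have h := tendsto_ae_condExp (μ := P₀) (ℱ := ℱ) fun ω => (Q.rnDeriv P₀ ω).toReal
  have hm : P₀[fun ω => (Q.rnDeriv P₀ ω).toReal | ⨆ n, ℱ n] =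
      fun ω => (Q.rnDeriv P₀ ω).toReal :=
    condExp_of_stronglyMeasurable (iSup_le ℱ.le)
      (by
        rw [hℱ]
        exact (Measure.measurable_rnDeriv Q P₀).ennreal_toReal.stronglyMeasurable)
      Measure.integrable_toReal_rnDeriv
  rwa [hm] at h

theorem setIntegral_densityProcess [IsProbabilityMeasure P₀] [IsProbabilityMeasure Q]
    (hQ : Q ≪ P₀) (ℱ : Filtration ℕ m) (n : ℕ) {G : Set Ω} (hG : MeasurableSet[ℱ n] G) :
    ∫ ω in G, densityProcess ℱ P₀ Q n ω ∂P₀ = Q.real G := by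
  rw [densityProcess, setIntegral_condExp (ℱ.le n) Measure.integrable_toReal_rnDeriv hG,
    Measure.setIntegral_toReal_rnDeriv hQ]

theorem densityProcess_pos [IsProbabilityMeasure P₀] [IsProbabilityMeasure Q]
    (hQ : Q ≪ P₀) (hQ' : P₀ ≪ Q) (ℱ : Filtration ℕ m) :
    ∀ᵐ ω ∂P₀, ∀ n, 0 < densityProcess ℱ P₀ Q n ω := by
  refine ae_all_iff.2 fun n => ?_
  have hG : MeasurableSet[ℱ n] {ω | densityProcess ℱ P₀ Q n ω ≤ 0} :=
    (densityProcess_stronglyAdapted ℱ P₀ Q n).measurable measurableSet_Iic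
  have h1 := setIntegral_densityProcess hQ ℱ n hG
  have h2 : Q.real {ω | densityProcess ℱ P₀ Q n ω ≤ 0} ≤ 0 := by
    rw [← h1]
    exact setIntegral_nonpos (ℱ.le n _ hG) fun ω hω => hω
  have h3 := hQ' ((measureReal_eq_zero_iff (measure_ne_top _ _)).1
    (h2.antisymm measureReal_nonneg))
  filter_upwards [measure_eq_zero_iff_ae_notMem.1 h3] with ω hω
  exact not_le.1 hω

end Density

/-! ### Conditional expectations of bounded random variables -/

section Version

variable {Ω : Type*} {C m : MeasurableSpace Ω}

theorem exists_version_condExp (P : Measure Ω) (ξ : BddMeas m) {M : ℝ} (hM : ∀ ω, |ξ.1 ω| ≤ M) :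
    ∃ e : BddMeas C, e.1 =ᵐ[P] P[ξ.1 | C] ∧ ∀ ω, |e.1 ω| ≤ M := by
  by_cases hM0 : 0 ≤ M
  · have hbd : ∀ ω, |max (-M) (min M ((P[ξ.1 | C]) ω))| ≤ M := fun ω =>
      abs_le.2 ⟨le_max_left _ _, max_le (by linarith) (min_le_left _ _)⟩
    refine ⟨⟨fun ω => max (-M) (min M ((P[ξ.1 | C]) ω)),
      measurable_const.max (measurable_const.min stronglyMeasurable_condExp.measurable),
      M, hbd⟩, ?_, hbd⟩
    have hb : ∀ᵐ ω ∂P, |(P[ξ.1 | C]) ω| ≤ M :=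
      ae_bdd_abs_condExp_of_ae_bdd_abs (.of_forall hM)
    filter_upwards [hb] with ω hω
    rw [min_eq_right (abs_le.1 hω).2, max_eq_right (abs_le.1 hω).1]
  · have : IsEmpty Ω := ⟨fun ω => hM0 ((abs_nonneg _).trans (hM ω))⟩
    exact ⟨0, .of_forall fun ω => isEmptyElim ω, fun ω => isEmptyElim ω⟩

theorem integral_mul_sub_version_eq_zero (P : Measure Ω) [IsProbabilityMeasure P] (hC : C ≤ m)
    (ξ : BddMeas m) {e : BddMeas C} (he : e.1 =ᵐ[P] P[ξ.1 | C]) {w : Ω → ℝ}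
    (hw : StronglyMeasurable[C] w) (hint : Integrable (w * (ξ.1 - e.1)) P) :
    ∫ ω, (w * (ξ.1 - e.1)) ω ∂P = 0 := by
  have hi : Integrable e.1 P := BddMeas.integrable (Subalgebra.inclusion (BddMeas.mono hC) e) P
  have hξ := BddMeas.integrable ξ P
  have h1 := condExp_mul_of_stronglyMeasurable_left hw hint (hξ.sub hi)
  have h2 := condExp_sub hξ hi C
  rw [condExp_of_stronglyMeasurable hC e.2.1.stronglyMeasurable hi] at h2
  rw [← integral_condExp hC]
  refine integral_eq_zero_of_ae ?_
  filter_upwards [h1, h2, he] with ω h1 h2 h3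
  rw [h1, Pi.mul_apply, h2, Pi.sub_apply, h3, sub_self, mul_zero, Pi.zero_apply]

/-- Where `C` has the same trace as the full σ-algebra, conditioning on `C` does nothing. -/
theorem version_eq_of_forall_measurableSet (P : Measure Ω) [IsProbabilityMeasure P] (hC : C ≤ m)
    (ξ : BddMeas m) {e : BddMeas C} (he : e.1 =ᵐ[P] P[ξ.1 | C]) {B : Set Ω}
    (hB : MeasurableSet[C] B) (hBm : ∀ s, MeasurableSet[m] s → MeasurableSet[C] (s ∩ B)) :
    ∀ᵐ ω ∂P, ω ∈ B → e.1 ω = ξ.1 ω := by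
  have h1 := condExp_indicator (m := C) (BddMeas.integrable ξ P) hB
  have hmeas : Measurable[C] (B.indicator ξ.1) := by
    intro t ht
    have ht' := hBm _ (ξ.2.1 ht)
    by_cases h0 : (0 : ℝ) ∈ t
    · convert ht'.union hB.compl using 1
      ext ω
      by_cases hω : ω ∈ B <;> simp [hω, h0]
    · convert ht' using 1
      ext ω
      by_cases hω : ω ∈ B <;> simp [hω, h0]
  rw [condExp_of_stronglyMeasurable hC hmeas.stronglyMeasurable
    ((BddMeas.integrable ξ P).indicator (hC _ hB))] at h1
  filter_upwards [h1, he] with ω h1 h2 hω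
  rw [Set.indicator_of_mem hω, Set.indicator_of_mem hω] at h1
  rw [h1, h2]

end Version

/-! ### Pasting -/

section Paste

variable {Ω : Type*} {m : MeasurableSpace Ω} {ℱ : Filtration ℕ m} {σ : Ω → WithTop ℕ}

open Classical in
/-- The restriction of a random time `σ` to an event `A`: it equals `σ` on `A` and `∞` elsewhere. -/
noncomputable def restrictTime (σ : Ω → WithTop ℕ) (A : Set Ω) : Ω → WithTop ℕ :=
  fun ω => if ω ∈ A then σ ω else ⊤

theorem isStoppingTime_restrictTime (hσ : IsStoppingTime ℱ σ) {A : Set Ω}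
    (hA : MeasurableSet[hσ.measurableSpace] A) : IsStoppingTime ℱ (restrictTime σ A) := by
  intro n
  have : {ω | restrictTime σ A ω ≤ WithTop.some n} = A ∩ {ω | σ ω ≤ WithTop.some n} := by
    ext ω
    by_cases h : ω ∈ A <;> simp [restrictTime, h]
  rw [this]
  exact hA.2 n

theorem measurableSet_eq_top (hσ : IsStoppingTime ℱ σ) (hℱ : ⨆ n, ℱ n = m) {s : Set Ω}
    (hs : MeasurableSet[m] s) : MeasurableSet[hσ.measurableSpace] (s ∩ {ω | σ ω = ⊤}) := by
  have htop : MeasurableSet[m] {ω | σ ω = ⊤} := by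
    have : {ω | σ ω = ⊤} = (⋃ n : ℕ, {ω | σ ω ≤ n})ᶜ := by
      ext ω
      induction h : σ ω using WithTop.recTopCoe with
      | top => simp [h]
      | coe k => simpa [h] using ⟨k, le_rfl⟩
    rw [this]
    exact (MeasurableSet.iUnion fun n => ℱ.le n _ (hσ n)).compl
  refine ⟨by rw [hℱ]; exact hs.inter htop, fun n => ?_⟩
  have : s ∩ {ω | σ ω = ⊤} ∩ {ω | σ ω ≤ WithTop.some n} = ∅ := by
    ext ω
    simp only [Set.mem_inter_iff, Set.mem_ofPred_eq, Set.mem_empty_iff_false, iff_false, not_and]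
    rintro ⟨-, h⟩
    simp [h]
  rw [this]
  exact @MeasurableSet.empty Ω (ℱ n)

variable {P₀ Q₀ Q R : Measure Ω} [IsProbabilityMeasure P₀]
  [IsProbabilityMeasure Q₀] [IsProbabilityMeasure Q] [IsProbabilityMeasure R]

/-- By Lévy's upward theorem the density processes converge to the densities; on `{τ < ∞}` the
pasted process is eventually a constant multiple of the density process of `Q`. -/
theorem rnDeriv_of_pasted (hℱ : ⨆ n, ℱ n = m) {A : Set Ω}
    (hRL : ∀ n, densityProcess ℱ P₀ R n =ᵐ[P₀]
      pastedProcess ℱ P₀ Q₀ Q (restrictTime σ A) n) :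
    ∀ᵐ ω ∂P₀, (ω ∈ A ∧ σ ω ≠ ⊤ → (R.rnDeriv P₀ ω).toReal =
        stoppedValue (densityProcess ℱ P₀ Q₀) σ ω / stoppedValue (densityProcess ℱ P₀ Q) σ ω *
          (Q.rnDeriv P₀ ω).toReal) ∧
      (¬ (ω ∈ A ∧ σ ω ≠ ⊤) → (R.rnDeriv P₀ ω).toReal = (Q₀.rnDeriv P₀ ω).toReal) := by
  filter_upwards [tendsto_densityProcess (P₀ := P₀) ℱ hℱ R,
    tendsto_densityProcess (P₀ := P₀) ℱ hℱ Q, tendsto_densityProcess (P₀ := P₀) ℱ hℱ Q₀,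
    ae_all_iff.2 hRL] with ω hR hQ hQ₀ hL
  simp_rw [hL] at hR
  constructor
  · rintro ⟨hA, htop⟩
    have hτ : restrictTime σ A ω = σ ω := if_pos hA
    obtain ⟨k, hk⟩ := WithTop.ne_top_iff_exists.1 htop
    refine tendsto_nhds_unique hR ((hQ.const_mul _).congr' ?_)
    filter_upwards [eventually_gt_atTop k] with n hn
    have h1 : ¬ ((n : WithTop ℕ) ≤ restrictTime σ A ω) := by
      rw [hτ, ← hk]
      exact not_le.2 (WithTop.coe_lt_coe.2 hn)
    rw [pastedProcess, if_neg h1]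
    simp only [stoppedValue, hτ]
    ring
  · intro hA
    have hτ : restrictTime σ A ω = ⊤ := by
      by_cases h : ω ∈ A
      · rw [restrictTime, if_pos h]
        exact not_not.1 fun h' => hA ⟨h, h'⟩
      · exact if_neg h
    refine tendsto_nhds_unique hR (hQ₀.congr fun n => ?_)
    rw [pastedProcess, if_pos (by rw [hτ]; exact le_top)]

theorem absolutelyContinuous_of_pasted (hℱ : ⨆ n, ℱ n = m) {A : Set Ω}
    (hQ₀ : Q₀ ≪ P₀) (hQ₀' : P₀ ≪ Q₀) (hQ : Q ≪ P₀) (hQ' : P₀ ≪ Q) (hR : R ≪ P₀)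
    (hRL : ∀ n, densityProcess ℱ P₀ R n =ᵐ[P₀]
      pastedProcess ℱ P₀ Q₀ Q (restrictTime σ A) n) : P₀ ≪ R := by
  rw [← Measure.withDensity_rnDeriv_eq R P₀ hR]
  refine withDensity_absolutelyContinuous' (Measure.measurable_rnDeriv _ _).aemeasurable ?_
  have hne : ∀ (P : Measure Ω) [IsProbabilityMeasure P], P₀ ≪ P →
      ∀ᵐ ω ∂P₀, 0 < (P.rnDeriv P₀ ω).toReal := fun P _ hP => by
    filter_upwards [Measure.rnDeriv_pos' hP, Measure.rnDeriv_lt_top P P₀] with ω h1 h2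
    exact ENNReal.toReal_pos h1.ne' h2.ne
  filter_upwards [rnDeriv_of_pasted hℱ hRL, hne Q hQ', hne Q₀ hQ₀',
    densityProcess_pos hQ hQ' ℱ, densityProcess_pos hQ₀ hQ₀' ℱ] with ω h1 h2 h3 h4 h5 h0
  by_cases h : ω ∈ A ∧ σ ω ≠ ⊤
  · have := h1.1 h
    rw [h0, ENNReal.toReal_zero] at this
    exact (mul_pos (div_pos (h5 _) (h4 _)) h2).ne this
  · have := h1.2 h
    rw [h0, ENNReal.toReal_zero] at this
    exact h3.ne this

/-- Up to the time `τ` the density process of the pasting is the one of `Q₀`, so the two measures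
agree on each `G ∩ {σ = n}`, `n ≤ ∞`. -/
theorem measure_eq_of_pasted (hσ : IsStoppingTime ℱ σ) (hℱ : ⨆ n, ℱ n = m) {A : Set Ω}
    (hQ₀ : Q₀ ≪ P₀) (hR : R ≪ P₀)
    (hRL : ∀ n, densityProcess ℱ P₀ R n =ᵐ[P₀]
      pastedProcess ℱ P₀ Q₀ Q (restrictTime σ A) n) {G : Set Ω}
    (hG : MeasurableSet[hσ.measurableSpace] G) : R G = Q₀ G := by
  have hle := hσ.measurableSpace_le
  have hpiece : ∀ n : WithTop ℕ, MeasurableSet[m] (G ∩ {ω | σ ω = n}) ∧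
      R (G ∩ {ω | σ ω = n}) = Q₀ (G ∩ {ω | σ ω = n}) := by
    intro n
    induction n using WithTop.recTopCoe with
    | top =>
      have h1 := hle _ (measurableSet_eq_top hσ hℱ (hle _ hG))
      refine ⟨h1, ?_⟩
      rw [← measureReal_eq_measureReal_iff, ← Measure.setIntegral_toReal_rnDeriv hR,
        ← Measure.setIntegral_toReal_rnDeriv hQ₀]
      refine setIntegral_congr_ae h1 ?_
      filter_upwards [rnDeriv_of_pasted hℱ hRL] with ω hω hmem
      exact hω.2 fun h => h.2 hmem.2
    | coe n =>
      have h1 : MeasurableSet[ℱ n] (G ∩ {ω | σ ω = WithTop.some n}) :=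
        (hσ.measurableSet_inter_eq_iff G n).1 (hG.inter (hσ.measurableSet_eq' n))
      refine ⟨ℱ.le n _ h1, ?_⟩
      rw [← measureReal_eq_measureReal_iff, ← setIntegral_densityProcess hR ℱ n h1,
        ← setIntegral_densityProcess hQ₀ ℱ n h1]
      refine setIntegral_congr_ae (ℱ.le n _ h1) ?_
      filter_upwards [hRL n] with ω hω hmem
      rw [hω, pastedProcess, if_pos]
      by_cases h : ω ∈ A
      · rw [restrictTime, if_pos h]
        exact hmem.2.ge
      · rw [restrictTime, if_neg h]
        exact le_top
  have hU : G = ⋃ n : WithTop ℕ, G ∩ {ω | σ ω = n} := by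
    ext ω
    simp
  have hd : Pairwise (Function.onFun Disjoint fun n : WithTop ℕ => G ∩ {ω | σ ω = n}) :=
    fun i j hij => Set.disjoint_left.2 fun ω h1 h2 => hij (h1.2.symm.trans h2.2)
  rw [hU, measure_iUnion hd fun n => (hpiece n).1, measure_iUnion hd fun n => (hpiece n).1]
  exact tsum_congr fun n => (hpiece n).2

/-- The conditional expectation of the pasting: on `A` it is the one of `Q`, elsewhere the one of
`Q₀`. On `A ∩ {σ < ∞}` the density of the pasting is a `σ`-past-measurable multiple of the density
of `Q`, and such a factor does not change the conditional expectation; on `{σ = ∞}` all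
conditional expectations equal `ξ`. -/
theorem version_of_pasted (hσ : IsStoppingTime ℱ σ) (hℱ : ⨆ n, ℱ n = m) {A : Set Ω}
    (hA : MeasurableSet[hσ.measurableSpace] A)
    (hQ₀ : Q₀ ≪ P₀) (hQ₀' : P₀ ≪ Q₀) (hQ : Q ≪ P₀) (hQ' : P₀ ≪ Q) (hR : R ≪ P₀)
    (hRL : ∀ n, densityProcess ℱ P₀ R n =ᵐ[P₀]
      pastedProcess ℱ P₀ Q₀ Q (restrictTime σ A) n) (ξ : BddMeas m)
    {e₀ e₁ : BddMeas hσ.measurableSpace} (he₀ : e₀.1 =ᵐ[Q₀] Q₀[ξ.1 | hσ.measurableSpace])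
    (he₁ : e₁.1 =ᵐ[Q] Q[ξ.1 | hσ.measurableSpace]) :
    (ind hA * e₁ + ind hA.compl * e₀).1 =ᵐ[R] R[ξ.1 | hσ.measurableSpace] := by
  have hle := hσ.measurableSpace_le
  set e : BddMeas hσ.measurableSpace := ind hA * e₁ + ind hA.compl * e₀
  have heA : ∀ ω ∈ A, e.1 ω = e₁.1 ω := fun ω => ind_mul_add_of_mem hA e₀ e₁
  have heA' : ∀ ω ∉ A, e.1 ω = e₀.1 ω := fun ω => ind_mul_add_of_notMem hA e₀ e₁
  have htop : MeasurableSet[hσ.measurableSpace] {ω | σ ω = ⊤} := by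
    have := measurableSet_eq_top hσ hℱ MeasurableSet.univ
    rwa [Set.univ_inter] at this
  have hE₀ := hQ₀' (version_eq_of_forall_measurableSet Q₀ hle ξ he₀ htop
    fun s hs => measurableSet_eq_top hσ hℱ hs)
  have hE₁ := hQ' (version_eq_of_forall_measurableSet Q hle ξ he₁ htop
    fun s hs => measurableSet_eq_top hσ hℱ hs)
  let g : Ω → ℝ := fun ω =>
    stoppedValue (densityProcess ℱ P₀ Q₀) σ ω / stoppedValue (densityProcess ℱ P₀ Q) σ ω
  have hprog : ∀ P : Measure Ω,
      Measurable[hσ.measurableSpace] (stoppedValue (densityProcess ℱ P₀ P) σ) := fun P =>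
    measurable_stoppedValue
      (densityProcess_stronglyAdapted ℱ P₀ P).isStronglyProgressive_of_discrete hσ
  have hg : Measurable[hσ.measurableSpace] g := (hprog Q₀).div (hprog Q)
  refine ae_eq_condExp_of_forall_integral_mul_eq_zero hle R ξ e fun G hG => ?_
  have hB : MeasurableSet[hσ.measurableSpace] (A ∩ {ω | σ ω = ⊤}ᶜ) := hA.inter htop.compl
  set B := A ∩ {ω | σ ω = ⊤}ᶜ
  let w₁ : Ω → ℝ := (G ∩ B).indicator g
  let w₀ : Ω → ℝ := (G ∩ Bᶜ).indicator 1
  have hw₁ : StronglyMeasurable[hσ.measurableSpace] w₁ :=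
    (hg.indicator (hG.inter hB)).stronglyMeasurable
  have hw₀ : StronglyMeasurable[hσ.measurableSpace] w₀ :=
    (ind (hG.inter hB.compl)).2.1.stronglyMeasurable
  -- on `A ∩ {σ = ∞}` the density is that of `Q₀`, but `e₀ = ξ = e₁` there
  have hD : ∀ᵐ ω ∂P₀, (R.rnDeriv P₀ ω).toReal • ((ξ.1 ω - e.1 ω) * G.indicator 1 ω) =
      (Q.rnDeriv P₀ ω).toReal • (w₁ * (ξ.1 - e₁.1)) ω +
      (Q₀.rnDeriv P₀ ω).toReal • (w₀ * (ξ.1 - e₀.1)) ω := by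
    filter_upwards [rnDeriv_of_pasted hℱ hRL, hE₀, hE₁] with ω h1 h2 h3
    by_cases hωG : ω ∈ G
    swap
    · simp [w₁, w₀, hωG]
    by_cases hωB : ω ∈ B
    · have := h1.1 hωB
      simp only [w₁, w₀, Pi.mul_apply, Pi.sub_apply, smul_eq_mul]
      rw [Set.indicator_of_mem hωG, Set.indicator_of_mem (show ω ∈ G ∩ B from ⟨hωG, hωB⟩),
        Set.indicator_of_notMem (fun h => h.2 hωB), this, heA ω hωB.1]
      simp only [g, Pi.one_apply]
      ring
    · have := h1.2 hωB
      have he : e.1 ω = e₀.1 ω := by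
        by_cases hωA : ω ∈ A
        · have ht : σ ω = ⊤ := not_not.1 fun h => hωB ⟨hωA, h⟩
          rw [heA ω hωA, h2 ht, h3 ht]
        · exact heA' ω hωA
      simp only [w₁, w₀, Pi.mul_apply, Pi.sub_apply, smul_eq_mul]
      rw [Set.indicator_of_mem hωG, Set.indicator_of_mem (show ω ∈ G ∩ Bᶜ from ⟨hωG, hωB⟩),
        Set.indicator_of_notMem (fun h => hωB h.2), this, he]
      simp only [Pi.one_apply]
      ring
  let ι := Subalgebra.inclusion (BddMeas.mono hle)
  have hi₀ : Integrable (w₀ * (ξ.1 - e₀.1)) Q₀ :=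
    BddMeas.integrable (ι (ind (hG.inter hB.compl)) * (ξ - ι e₀)) Q₀
  have hiR : Integrable (fun ω => (ξ.1 ω - e.1 ω) * G.indicator 1 ω) R :=
    BddMeas.integrable ((ξ - ι e) * ι (ind hG)) R
  have hj₀ := (integrable_rnDeriv_smul_iff hQ₀).2 hi₀
  have hjR := (integrable_rnDeriv_smul_iff hR).2 hiR
  have hj₁ : Integrable (fun ω => (Q.rnDeriv P₀ ω).toReal • (w₁ * (ξ.1 - e₁.1)) ω) P₀ := by
    refine (hjR.sub hj₀).congr ?_
    filter_upwards [hD] with ω hω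
    rw [Pi.sub_apply, hω, add_sub_cancel_right]
  have hi₁ := (integrable_rnDeriv_smul_iff hQ).1 hj₁
  rw [← integral_rnDeriv_smul hR, integral_congr_ae hD, integral_add hj₁ hj₀,
    integral_rnDeriv_smul hQ, integral_rnDeriv_smul hQ₀,
    integral_mul_sub_version_eq_zero Q hle ξ he₁ hw₁ hi₁,
    integral_mul_sub_version_eq_zero Q₀ hle ξ he₀ hw₀ hi₀, add_zero]

end Paste

theorem IsStable.exists_paste {Ω : Type*} {m : MeasurableSpace Ω} {ℱ : Filtration ℕ m}
    {σ : Ω → WithTop ℕ} {S : Set (Measure Ω)} {P₀ : Measure Ω}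
    (hS : ∀ P ∈ S, IsProbabilityMeasure P) (hP₀ : IsReferenceMeasure S P₀)
    (hstab : IsStable ℱ P₀ S) (hσ : IsStoppingTime ℱ σ) (hℱ : ⨆ n, ℱ n = m)
    {Q₀ Q : Measure Ω} (hQ₀ : Q₀ ∈ S) (hQ₀' : P₀ ≪ Q₀) (hQ : Q ∈ S) (hQ' : P₀ ≪ Q) {A : Set Ω}
    (hA : MeasurableSet[hσ.measurableSpace] A) :
    ∃ R ∈ S, P₀ ≪ R ∧ (∀ G, MeasurableSet[hσ.measurableSpace] G → R G = Q₀ G) ∧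
      ∀ (ξ : BddMeas m) (e₀ e₁ : BddMeas hσ.measurableSpace),
        e₀.1 =ᵐ[Q₀] Q₀[ξ.1 | hσ.measurableSpace] → e₁.1 =ᵐ[Q] Q[ξ.1 | hσ.measurableSpace] →
        (ind hA * e₁ + ind hA.compl * e₀).1 =ᵐ[R] R[ξ.1 | hσ.measurableSpace] := by
  have := hP₀.isProbabilityMeasure
  have := hS _ hQ₀
  have := hS _ hQ
  have h₀ := hP₀.dominates _ hQ₀
  have h₁ := hP₀.dominates _ hQ
  obtain ⟨R, hR, hRP, hRL⟩ := hstab Q₀ hQ₀ Q hQ h₀ hQ₀' h₁ hQ' _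
    (isStoppingTime_restrictTime hσ hA)
  have := hS _ hR
  exact ⟨R, hR, absolutelyContinuous_of_pasted hℱ h₀ hQ₀' h₁ hQ' hRP hRL,
    fun G hG => measure_eq_of_pasted hσ hℱ h₀ hRP hRL hG,
    fun ξ e₀ e₁ he₀ he₁ => version_of_pasted hσ hℱ hA h₀ hQ₀' h₁ hQ' hRP hRL ξ he₀ he₁⟩

/-! ### Essential suprema -/

section EssSup

variable {Ω : Type*} {C m : MeasurableSpace Ω}

/-- A countable subfamily with the same essential supremum: take a sequence whose integrals tend to
the supremum of all integrals, and pass to its partial suprema. -/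
theorem exists_seq_iSup_ae_upperBound (μ : Measure Ω) [IsFiniteMeasure μ] {V : Set (Ω → ℝ)}
    (hne : V.Nonempty) (hmeas : ∀ f ∈ V, Measurable[m] f) {M : ℝ}
    (hM : ∀ f ∈ V, ∀ ω, |f ω| ≤ M) (hsup : ∀ f ∈ V, ∀ g ∈ V, f ⊔ g ∈ V) :
    ∃ f : ℕ → Ω → ℝ, (∀ n, f n ∈ V) ∧ Monotone f ∧ ∀ g ∈ V, g ≤ᵐ[μ] fun ω => ⨆ n, f n ω := by
  have hint : ∀ f ∈ V, Integrable f μ := fun f hf =>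
    Integrable.of_bound (hmeas f hf).aestronglyMeasurable M (.of_forall (hM f hf))
  let I : Set ℝ := (fun f : Ω → ℝ => ∫ ω, f ω ∂μ) '' V
  have hIbdd : BddAbove I := by
    refine ⟨M * μ.real Set.univ, ?_⟩
    rintro _ ⟨f, hf, rfl⟩
    exact (le_abs_self _).trans (norm_integral_le_of_norm_le_const (f := f) (.of_forall (hM f hf)))
  obtain ⟨u, -, hu, huI⟩ := exists_seq_tendsto_sSup (hne.image _) hIbdd
  choose g hg hgu using huI
  let f : ℕ → Ω → ℝ := partialSups g
  have hf : ∀ n, f n ∈ V := fun n => by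
    induction n with
    | zero => simpa [f] using hg 0
    | succ n ih =>
      have : f (n + 1) = f n ⊔ g (n + 1) := partialSups_succ g n
      rw [this]
      exact hsup _ ih _ (hg _)
  have hmono : Monotone f := (partialSups g).monotone
  refine ⟨f, hf, hmono, fun k hk => ?_⟩
  have hbdd : ∀ ω, BddAbove (Set.range fun n => f n ω) := fun ω =>
    ⟨M, by rintro _ ⟨n, rfl⟩; exact (abs_le.1 (hM _ (hf n) ω)).2⟩
  have hlim : ∀ ω, Tendsto (fun n => f n ω) atTop (𝓝 (⨆ n, f n ω)) := fun ω =>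
    tendsto_atTop_ciSup (fun i j hij => hmono hij ω) (hbdd ω)
  set h : Ω → ℝ := fun ω => ⨆ n, f n ω
  have hhmeas : Measurable[m] h := measurable_of_tendsto_metrizable
    (fun n => hmeas _ (hf n)) (tendsto_pi_nhds.2 hlim)
  have hhM : ∀ ω, |h ω| ≤ M := fun ω =>
    le_of_tendsto' (hlim ω).abs fun n => hM _ (hf n) ω
  have hhint : Integrable h μ :=
    Integrable.of_bound hhmeas.aestronglyMeasurable M (.of_forall hhM)
  have hdct : ∀ F : ℕ → Ω → ℝ, (∀ n, F n ∈ V) → ∀ G : Ω → ℝ,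
      (∀ ω, Tendsto (fun n => F n ω) atTop (𝓝 (G ω))) →
      Tendsto (fun n => ∫ ω, F n ω ∂μ) atTop (𝓝 (∫ ω, G ω ∂μ)) := fun F hF G hG =>
    tendsto_integral_of_dominated_convergence (fun _ => M)
      (fun n => (hmeas _ (hF n)).aestronglyMeasurable) (integrable_const M)
      (fun n => .of_forall (hM _ (hF n))) (.of_forall hG)
  have h1 : sSup I ≤ ∫ ω, h ω ∂μ := by
    refine le_of_tendsto_of_tendsto' hu (hdct f hf h hlim) fun n => ?_
    rw [← hgu n]
    exact integral_mono (hint _ (hg n)) (hint _ (hf n)) (le_partialSups g n)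
  have h2 : ∫ ω, (k ⊔ h) ω ∂μ ≤ sSup I := by
    refine le_of_tendsto' (hdct (fun n => k ⊔ f n) (fun n => hsup _ hk _ (hf n)) (k ⊔ h)
      fun ω => tendsto_const_nhds.sup_nhds (hlim ω)) fun n => ?_
    exact le_csSup hIbdd ⟨_, hsup _ hk _ (hf n), rfl⟩
  have hsupint : Integrable (k ⊔ h) μ := (hint k hk).sup hhint
  have h3 : ∫ ω, ((k ⊔ h) ω - h ω) ∂μ = 0 := by
    refine le_antisymm ?_ (integral_nonneg fun ω => sub_nonneg.2 le_sup_right)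
    rw [integral_sub hsupint hhint]
    linarith
  have h4 := (integral_eq_zero_iff_of_nonneg (f := fun ω => (k ⊔ h) ω - h ω)
    (fun ω => sub_nonneg.2 le_sup_right) (hsupint.sub hhint)).1 h3
  filter_upwards [h4] with ω hω
  exact le_sup_left.trans (sub_eq_zero.1 hω).le

/-- Stability under pasting at the σ-algebra `C`: for `Q₀, Q ∈ S` equivalent to `P₀` and `A ∈ C`
there is an element of `S` that agrees with `Q₀` on `C` and whose `C`-conditional expectations are
those of `Q` on `A` and those of `Q₀` off `A`. -/
def IsStableAt (C : MeasurableSpace Ω) {m : MeasurableSpace Ω} (S : Set (Measure Ω))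
    (P₀ : Measure Ω) : Prop :=
  ∀ Q₀ ∈ S, P₀ ≪ Q₀ → ∀ Q ∈ S, P₀ ≪ Q → ∀ (A : Set Ω) (hA : MeasurableSet[C] A),
    ∃ R ∈ S, P₀ ≪ R ∧ (∀ G, MeasurableSet[C] G → R G = Q₀ G) ∧
      ∀ (ξ : BddMeas m) (e₀ e₁ : BddMeas C),
        e₀.1 =ᵐ[Q₀] Q₀[ξ.1 | C] → e₁.1 =ᵐ[Q] Q[ξ.1 | C] →
        (ind hA * e₁ + ind hA.compl * e₀).1 =ᵐ[R] R[ξ.1 | C]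

variable {ρ : BddMeas m → ℝ} {P₀ : Measure Ω}

/-- A bound for the conditional expectations under all equivalent elements extends to all of
`𝒫`: integrated over an event of `C` it is affine in the measure, and every `P ∈ 𝒫` is the limit of
the equivalent measures `(1 - ε) P + ε Q`. -/
theorem condExp_le_of_forall_equivalent (hC : C ≤ m)
    (hP₀ : IsReferenceMeasure (representingSet ρ) P₀) (ξ : BddMeas m) (h : BddMeas C)
    (hle : ∀ Q ∈ representingSet ρ, P₀ ≪ Q → Q[ξ.1 | C] ≤ᵐ[P₀] h.1)
    {P : Measure Ω} (hP : P ∈ representingSet ρ) : P[ξ.1 | C] ≤ᵐ[P] h.1 := by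
  obtain ⟨Pe, hPe, hPe'⟩ := hP₀.exists_equivalent
  have := hP.1
  have := hPe.1
  have hhint : ∀ (Q : Measure Ω) [IsProbabilityMeasure Q], Integrable h.1 Q := fun Q _ =>
    BddMeas.integrable (Subalgebra.inclusion (BddMeas.mono hC) h) Q
  have hset : ∀ G, MeasurableSet[C] G → ∫ ω in G, ξ.1 ω ∂P ≤ ∫ ω in G, h.1 ω ∂P := by
    intro G hG
    let D : Ω → ℝ := G.indicator (ξ.1 - h.1)
    have hD : ∀ (Q : Measure Ω) [IsProbabilityMeasure Q], Integrable D Q := fun Q _ =>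
      ((BddMeas.integrable ξ Q).sub (hhint Q)).indicator (hC _ hG)
    have hDint : ∀ (Q : Measure Ω) [IsProbabilityMeasure Q],
        ∫ ω, D ω ∂Q = ∫ ω in G, ξ.1 ω ∂Q - ∫ ω in G, h.1 ω ∂Q := fun Q _ => by
      rw [integral_indicator (hC _ hG)]
      exact integral_sub (BddMeas.integrable ξ Q).integrableOn (hhint Q).integrableOn
    have hmix : ∀ ε ∈ Set.Ioo (0 : ℝ) 1,
        (1 - ε) * ∫ ω, D ω ∂P + ε * ∫ ω, D ω ∂Pe ≤ 0 := by
      intro ε hε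
      rw [← integral_mixMeasure hε.1.le hε.2.le (hD P) (hD Pe)]
      have hQ := mixMeasure_mem hε.1.le hε.2.le hP hPe
      have := hQ.1
      rw [hDint, ← setIntegral_condExp hC (BddMeas.integrable ξ _) hG, sub_nonpos]
      refine setIntegral_mono_ae integrable_condExp.integrableOn (hhint _).integrableOn ?_
      exact (hP₀.dominates _ hQ).ae_le (hle _ hQ
        (hPe'.trans (absolutelyContinuous_mixMeasure_right hε.1 _ _)))
    have hlim : Tendsto (fun ε : ℝ => (1 - ε) * ∫ ω, D ω ∂P + ε * ∫ ω, D ω ∂Pe) (𝓝[>] 0)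
        (𝓝 (∫ ω, D ω ∂P)) := by
      refine tendsto_nhdsWithin_of_tendsto_nhds (Continuous.tendsto' (by fun_prop) _ _ (by simp))
    have := le_of_tendsto hlim (eventually_of_mem (Ioo_mem_nhdsGT one_pos) hmix)
    rw [hDint] at this
    linarith
  have hG : MeasurableSet[C] {ω | h.1 ω < (P[ξ.1 | C]) ω} :=
    measurableSet_lt h.2.1 stronglyMeasurable_condExp.measurable
  set G := {ω | h.1 ω < (P[ξ.1 | C]) ω}
  have hGi : Integrable (G.indicator (P[ξ.1 | C] - h.1)) P :=
    (integrable_condExp.sub (hhint P)).indicator (hC _ hG)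
  have hnn : 0 ≤ G.indicator (P[ξ.1 | C] - h.1) :=
    Set.indicator_nonneg fun ω hω => sub_nonneg.2 (le_of_lt hω)
  have h0 : ∫ ω, G.indicator (P[ξ.1 | C] - h.1) ω ∂P = 0 := by
    refine le_antisymm ?_ (integral_nonneg hnn)
    rw [integral_indicator (hC _ hG)]
    have := hset G hG
    rw [← setIntegral_condExp hC (BddMeas.integrable ξ P) hG] at this
    refine (integral_sub integrable_condExp.integrableOn (hhint P).integrableOn).trans_le ?_
    linarith
  rw [integral_eq_zero_iff_of_nonneg hnn hGi] at h0
  filter_upwards [h0] with ω hω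
  by_contra hlt
  have hmem : ω ∈ G := not_le.1 hlt
  rw [Set.indicator_of_mem hmem] at hω
  exact hlt (sub_eq_zero.1 hω).le

/-- By pasting, the versions of the `C`-conditional expectations under the equivalent elements
form a family that is closed under pointwise maxima. -/
theorem exists_isCondEssSup (hC : C ≤ m) (hP₀ : IsReferenceMeasure (representingSet ρ) P₀)
    (hstab : IsStableAt C (representingSet ρ) P₀) (ξ : BddMeas m) :
    ∃ (Q : ℕ → Measure Ω) (e : ℕ → BddMeas C) (h : BddMeas C) (M : ℝ),
      (∀ n, Q n ∈ representingSet ρ ∧ P₀ ≪ Q n ∧ (e n).1 =ᵐ[Q n] (Q n)[ξ.1 | C]) ∧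
      (∀ n ω, |(e n).1 ω| ≤ M) ∧ (∀ ω, Tendsto (fun n => (e n).1 ω) atTop (𝓝 (h.1 ω))) ∧
      IsCondEssSup C (representingSet ρ) P₀ ξ.1 h.1 := by
  have := hP₀.isProbabilityMeasure
  obtain ⟨M, -, hM⟩ := BddMeas.exists_bound ξ
  let V : Set (Ω → ℝ) := {f | (Measurable[C] f ∧ ∀ ω, |f ω| ≤ M) ∧
    ∃ Q ∈ representingSet ρ, P₀ ≪ Q ∧ f =ᵐ[Q] Q[ξ.1 | C]}
  have hver : ∀ Q ∈ representingSet ρ, P₀ ≪ Q → ∃ f ∈ V, f =ᵐ[Q] Q[ξ.1 | C] := by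
    intro Q hQ hQ'
    obtain ⟨e, he, heM⟩ := exists_version_condExp (C := C) Q ξ hM
    exact ⟨e.1, ⟨⟨e.2.1, heM⟩, Q, hQ, hQ', he⟩, he⟩
  have hne : V.Nonempty := by
    obtain ⟨Pe, hPe, hPe'⟩ := hP₀.exists_equivalent
    obtain ⟨f, hf, -⟩ := hver Pe hPe hPe'
    exact ⟨f, hf⟩
  have hsup : ∀ f ∈ V, ∀ g ∈ V, f ⊔ g ∈ V := by
    rintro f ⟨⟨hf, hfM⟩, Q, hQ, hQ', hfQ⟩ g ⟨⟨hg, hgM⟩, Q₁, hQ₁, hQ₁', hgQ⟩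
    have hA : MeasurableSet[C] {ω | f ω ≤ g ω} := measurableSet_le hf hg
    obtain ⟨R, hR, hR', -, hRv⟩ := hstab Q hQ hQ' Q₁ hQ₁ hQ₁' _ hA
    have h1 := hRv ξ ⟨f, hf, M, hfM⟩ ⟨g, hg, M, hgM⟩ hfQ hgQ
    have h2 : (ind hA * (⟨g, hg, M, hgM⟩ : BddMeas C) + ind hA.compl * ⟨f, hf, M, hfM⟩).1 =
        f ⊔ g := by
      ext ω
      by_cases hω : f ω ≤ g ω
      · exact (ind_mul_add_of_mem hA _ _ hω).trans (sup_eq_right.2 hω).symm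
      · exact (ind_mul_add_of_notMem hA _ _ hω).trans (sup_eq_left.2 (not_le.1 hω).le).symm
    rw [h2] at h1
    exact ⟨⟨hf.sup hg, fun ω => abs_max_le_max_abs_abs.trans (max_le (hfM ω) (hgM ω))⟩,
      R, hR, hR', h1⟩
  obtain ⟨f, hfV, hmono, hub⟩ := exists_seq_iSup_ae_upperBound P₀ hne
    (fun f hf => hf.1.1.mono hC le_rfl) (fun f hf => hf.1.2) hsup
  have hlim : ∀ ω, Tendsto (fun n => f n ω) atTop (𝓝 (⨆ n, f n ω)) := fun ω =>
    tendsto_atTop_ciSup (fun i j hij => hmono hij ω)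
      ⟨M, by rintro _ ⟨n, rfl⟩; exact (abs_le.1 ((hfV n).1.2 ω)).2⟩
  let h : BddMeas C := ⟨fun ω => ⨆ n, f n ω,
    Measurable.iSup fun n => (hfV n).1.1, M,
    fun ω => le_of_tendsto' (hlim ω).abs fun n => (hfV n).1.2 ω⟩
  choose Q hQ hQ' hfQ using fun n => (hfV n).2
  refine ⟨Q, fun n => ⟨f n, (hfV n).1.1, M, (hfV n).1.2⟩, h, M,
    fun n => ⟨hQ n, hQ' n, hfQ n⟩, fun n => (hfV n).1.2, hlim, h.2.1, fun P hP => ?_,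
    fun ζ _ hζ => ?_⟩
  · refine condExp_le_of_forall_equivalent hC hP₀ ξ h (fun Q hQ hQ' => ?_) hP
    obtain ⟨g, hg, hgQ⟩ := hver Q hQ hQ'
    filter_upwards [hub g hg, hQ'.ae_le hgQ] with ω h1 h2
    rw [← h2]
    exact h1
  · have : ∀ᵐ ω ∂P₀, ∀ n, f n ω ≤ ζ ω := by
      refine ae_all_iff.2 fun n => (hQ' n).ae_le ?_
      filter_upwards [hfQ n, hζ _ (hQ n)] with ω h1 h2
      rwa [h1]
    filter_upwards [this] with ω hω
    have : Nonempty ℕ := ⟨0⟩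
    exact ciSup_le hω

theorem IsCondEssSup.neg {S : Set (Measure Ω)} {ξ h : Ω → ℝ}
    (hsup : IsCondEssSup C S P₀ (-ξ) h) : IsCondEssInf C S P₀ ξ (-h) where
  measurable := hsup.measurable.neg
  lower P hP := by
    filter_upwards [hsup.upper P hP, condExp_neg (μ := P) ξ C] with ω h1 h2
    rw [h2] at h1
    exact neg_le.1 h1
  greatest ζ hζ hle := by
    have := hsup.least (-ζ) hζ.neg fun P hP => by
      filter_upwards [hle P hP, condExp_neg (μ := P) ξ C] with ω h1 h2
      rw [h2]
      exact neg_le_neg h1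
    filter_upwards [this] with ω hω
    exact le_neg.1 hω

end EssSup

/-! ### The order interval -/

section Interval

variable {Ω : Type*} {C m : MeasurableSpace Ω} {ρ : BddMeas m → ℝ} {P₀ : Measure Ω}

theorem integral_eq_of_measure_eq (hC : C ≤ m) {P Q : Measure Ω}
    (h : ∀ G, MeasurableSet[C] G → P G = Q G) (X : BddMeas C) :
    ∫ ω, X.1 ω ∂P = ∫ ω, X.1 ω ∂Q := by
  have : P.trim hC = Q.trim hC := @Measure.ext Ω C _ _ fun G hG => by
    rw [trim_measurableSet_eq hC hG, trim_measurableSet_eq hC hG, h G hG]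
  rw [integral_trim hC X.2.1.stronglyMeasurable, this,
    ← integral_trim hC X.2.1.stronglyMeasurable]

/-- Any `P ∈ 𝒫`, as a measure on `C`, can be combined with the `C`-conditional expectations of an
equivalent `Q`. As pasting requires equivalent measures, `P` is first replaced by
`(1 - ε) P + ε Q`. -/
theorem integral_version_le (hC : C ≤ m)
    (hstab : IsStableAt C (representingSet ρ) P₀) (ξ : BddMeas m) (η' η : BddMeas C)
    {P Q : Measure Ω} (hP : P ∈ representingSet ρ) (hQ : Q ∈ representingSet ρ) (hQ' : P₀ ≪ Q)
    {v : BddMeas C} (hv : v.1 =ᵐ[Q] Q[ξ.1 | C]) :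
    ∫ ω, ((v - η') * η).1 ω ∂P ≤ ρ ((ξ - Subalgebra.inclusion (BddMeas.mono hC) η') *
      Subalgebra.inclusion (BddMeas.mono hC) η) := by
  set ι := Subalgebra.inclusion (BddMeas.mono hC)
  have := hP.1
  have := hQ.1
  have hint : ∀ (T₀ : Measure Ω) [IsProbabilityMeasure T₀], Integrable ((v - η') * η).1 T₀ :=
    fun T₀ _ => BddMeas.integrable (ι ((v - η') * η)) T₀
  have hmix : ∀ ε ∈ Set.Ioo (0 : ℝ) 1,
      (1 - ε) * ∫ ω, ((v - η') * η).1 ω ∂P + ε * ∫ ω, ((v - η') * η).1 ω ∂Q ≤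
        ρ ((ξ - ι η') * ι η) := by
    intro ε hε
    rw [← integral_mixMeasure hε.1.le hε.2.le (hint P) (hint Q)]
    have hT₀ := mixMeasure_mem hε.1.le hε.2.le hP hQ
    have hPT := hQ'.trans (absolutelyContinuous_mixMeasure_right hε.1 P Q)
    set T₀ := mixMeasure ε P Q
    have := hT₀.1
    obtain ⟨T, hT, -, hTQ, hTv⟩ := hstab T₀ hT₀ hPT Q hQ hQ' Set.univ MeasurableSet.univ
    have := hT.1
    obtain ⟨M, -, hM⟩ := BddMeas.exists_bound ξ
    obtain ⟨e₀, he₀, -⟩ := exists_version_condExp (C := C) T₀ ξ hM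
    have hv' := hTv ξ e₀ v he₀ hv
    rw [show (ind MeasurableSet.univ * v + ind (MeasurableSet.univ (α := Ω)).compl * e₀ :
      BddMeas C).1 = v.1 from funext fun ω => ind_mul_add_of_mem _ _ _ (Set.mem_univ ω)] at hv'
    rw [← integral_eq_of_measure_eq hC hTQ, integral_version_sub_mul hC T ξ hv' η' η]
    exact hT.2 _
  have hlim : Tendsto (fun ε : ℝ => (1 - ε) * ∫ ω, ((v - η') * η).1 ω ∂P +
      ε * ∫ ω, ((v - η') * η).1 ω ∂Q) (𝓝[>] 0) (𝓝 (∫ ω, ((v - η') * η).1 ω ∂P)) :=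
    tendsto_nhdsWithin_of_tendsto_nhds (Continuous.tendsto' (by fun_prop) _ _ (by simp))
  exact le_of_tendsto hlim (eventually_of_mem (Ioo_mem_nhdsGT one_pos) hmix)

/-- For a given `η`, pasting on `{η ≥ 0}` provides conditional expectations that tend to the
essential supremum there and to the essential infimum on `{η < 0}`. If `η'` lies between the two
bounds, the limit of the corresponding `(E_Q[ξ | C] - η') η` is nonnegative. -/
theorem exists_essInf_essSup_mem_projKer (hC : C ≤ m) (hρ : IsSublinearOperator ρ)
    (hP₀ : IsReferenceMeasure (representingSet ρ) P₀)
    (hstab : IsStableAt C (representingSet ρ) P₀) (ξ : BddMeas m) :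
    ∃ lo hi : Ω → ℝ, IsCondEssInf C (representingSet ρ) P₀ ξ.1 lo ∧
      IsCondEssSup C (representingSet ρ) P₀ ξ.1 hi ∧
      ∀ (η' : BddMeas C), ∀ P ∈ representingSet ρ, lo ≤ᵐ[P] η'.1 → η'.1 ≤ᵐ[P] hi →
        η' ∈ projKer hC ρ ξ := by
  obtain ⟨Q₁, e₁, hi, M₁, hQ₁, hM₁, hlim₁, hhi⟩ := exists_isCondEssSup hC hP₀ hstab ξ
  obtain ⟨Q₀, e₀, lo, M₀, hQ₀, hM₀, hlim₀, hlo⟩ := exists_isCondEssSup hC hP₀ hstab (-ξ)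
  refine ⟨-lo.1, hi.1, hlo.neg, hhi, fun η' P hP hle₀ hle₁ => ?_⟩
  have := hP.1
  rw [mem_projKer_iff hC hρ]
  intro η
  have hA : MeasurableSet[C] {ω | 0 ≤ η.1 ω} := measurableSet_le measurable_const η.2.1
  let v : ℕ → BddMeas C := fun n => ind hA * e₁ n + ind hA.compl * (-e₀ n)
  let w : BddMeas C := ind hA * hi + ind hA.compl * (-lo)
  have hle : ∀ n, ∫ ω, ((v n - η') * η).1 ω ∂P ≤
      ρ ((ξ - Subalgebra.inclusion (BddMeas.mono hC) η') *
        Subalgebra.inclusion (BddMeas.mono hC) η) := by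
    intro n
    obtain ⟨R, hR, hR', -, hRv⟩ := hstab (Q₀ n) (hQ₀ n).1 (hQ₀ n).2.1 (Q₁ n) (hQ₁ n).1 (hQ₁ n).2.1
      _ hA
    refine integral_version_le hC hstab ξ η' η hP hR hR'
      (hRv ξ (-e₀ n) (e₁ n) ?_ (hQ₁ n).2.2)
    filter_upwards [(hQ₀ n).2.2, condExp_neg (μ := Q₀ n) ξ.1 C] with ω h1 h2
    change -((e₀ n).1 ω) = _
    have h1' : (e₀ n).1 ω = ((Q₀ n)[-ξ.1 | C]) ω := h1
    rw [h1', h2, Pi.neg_apply, neg_neg]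
  obtain ⟨K, hK0, hK⟩ := BddMeas.exists_bound η
  obtain ⟨L, -, hL⟩ := BddMeas.exists_bound η'
  have hlim : Tendsto (fun n => ∫ ω, ((v n - η') * η).1 ω ∂P) atTop
      (𝓝 (∫ ω, ((w - η') * η).1 ω ∂P)) := by
    refine tendsto_integral_of_dominated_convergence (fun _ => (max M₁ M₀ + L) * K)
      (fun n => (((v n - η') * η).2.1.mono hC le_rfl).aestronglyMeasurable)
      (integrable_const _) (fun n => .of_forall fun ω => ?_) (.of_forall fun ω => ?_)
    · change |((v n).1 ω - η'.1 ω) * η.1 ω| ≤ _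
      have hvb : |(v n).1 ω| ≤ max M₁ M₀ := by
        by_cases hω : 0 ≤ η.1 ω
        · rw [ind_mul_add_of_mem hA _ _ hω]
          exact (hM₁ n ω).trans (le_max_left _ _)
        · rw [ind_mul_add_of_notMem hA _ _ hω]
          exact ((abs_neg _).trans_le (hM₀ n ω)).trans (le_max_right _ _)
      have hsub := (abs_sub ((v n).1 ω) (η'.1 ω)).trans (add_le_add hvb (hL ω))
      rw [abs_mul]
      exact mul_le_mul hsub (hK ω) (abs_nonneg _) ((abs_nonneg _).trans hsub)
    · change Tendsto (fun n => ((v n).1 ω - η'.1 ω) * η.1 ω) atTop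
        (𝓝 ((w.1 ω - η'.1 ω) * η.1 ω))
      refine Tendsto.mul_const _ (Tendsto.sub_const ?_ _)
      by_cases hω : 0 ≤ η.1 ω
      · simp only [v, w, ind_mul_add_of_mem hA _ _ hω]
        exact hlim₁ ω
      · simp only [v, w, ind_mul_add_of_notMem hA _ _ hω]
        exact (hlim₀ ω).neg
  refine le_trans ?_ (le_of_tendsto' hlim hle)
  refine integral_nonneg_of_ae ?_
  filter_upwards [hle₀, hle₁] with ω h0 h1
  change 0 ≤ (w.1 ω - η'.1 ω) * η.1 ω
  by_cases hω : 0 ≤ η.1 ω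
  · rw [ind_mul_add_of_mem hA _ _ hω]
    exact mul_nonneg (sub_nonneg.2 h1) hω
  · rw [ind_mul_add_of_notMem hA _ _ hω]
    exact mul_nonneg_of_nonpos_of_nonpos (sub_nonpos.2 h0) (not_le.1 hω).le

theorem ae_le_of_trim_absolutelyContinuous (hC : C ≤ m) {P : Measure Ω}
    (hP : P₀.trim hC ≪ P.trim hC) {f g : Ω → ℝ} (hf : Measurable[C] f) (hg : Measurable[C] g)
    (h : f ≤ᵐ[P] g) : f ≤ᵐ[P₀] g :=
  ae_le_of_ae_le_trim (hm := hC) (hP.ae_le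
    ((StronglyMeasurable.ae_le_trim_iff hC hf.stronglyMeasurable hg.stronglyMeasurable).2 h))

end Interval

theorem theorem4p1 {Ω : Type*} {C m : MeasurableSpace Ω} (hC : C ≤ m)
    (ρ : BddMeas m → ℝ) (hρ : IsSublinearOperator ρ) (hcont : IsContinuousFromAbove ρ)
    (ξ : BddMeas m) :
    -- the linear functionals dominated by `ρ` are the expectations under the elements of `𝒫`
    (∀ E : BddMeas m →ₗ[ℝ] ℝ, (∀ X, E X ≤ ρ X) →
      ∃ P ∈ representingSet ρ, ∀ X : BddMeas m, E X = ∫ ω, X.1 ω ∂P) ∧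
    -- `ker f` is the set of all versions of the `E_P[ξ | C]`, `P ∈ 𝒫`
    projKer hC ρ ξ = {η' | ∃ P ∈ representingSet ρ, η'.1 =ᵐ[P] P[ξ.1 | C]} ∧
    -- a reference probability exists
    (∃ P₀ : Measure Ω, IsReferenceMeasure (representingSet ρ) P₀) ∧
    -- the stable case: the order interval, read `P`-a.s. for some `P ∈ 𝒫`, and read `P₀`-a.s. when
    -- all elements of `𝒫` are equivalent to `P₀` on `C` (for instance when `ρ` is proper)
    ∀ P₀ : Measure Ω, IsReferenceMeasure (representingSet ρ) P₀ →
      ∀ ℱ : Filtration ℕ m, ⨆ n, ℱ n = m →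
      ∀ (σ : Ω → WithTop ℕ) (hσ : IsStoppingTime ℱ σ), C = hσ.measurableSpace →
      IsStable ℱ P₀ (representingSet ρ) →
      ∃ lo hi : Ω → ℝ,
        IsCondEssInf C (representingSet ρ) P₀ ξ.1 lo ∧
        IsCondEssSup C (representingSet ρ) P₀ ξ.1 hi ∧
        {η' : BddMeas C | lo ≤ᵐ[P₀] η'.1 ∧ η'.1 ≤ᵐ[P₀] hi} ⊆ projKer hC ρ ξ ∧
        projKer hC ρ ξ =
          {η' | ∃ P ∈ representingSet ρ, lo ≤ᵐ[P] η'.1 ∧ η'.1 ≤ᵐ[P] hi} ∧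
        ((∀ P ∈ representingSet ρ, P₀.trim hC ≪ P.trim hC) →
          projKer hC ρ ξ = {η' | lo ≤ᵐ[P₀] η'.1 ∧ η'.1 ≤ᵐ[P₀] hi}) := by
  refine ⟨exists_mem_representingSet_eq_integral hρ hcont, projKer_eq_condExp hC hρ hcont ξ,
    exists_isReferenceMeasure hρ hcont, fun P₀ hP₀ ℱ hℱ σ hσ hCσ hstab => ?_⟩
  have hstabC : IsStableAt C (representingSet ρ) P₀ := by
    subst hCσ
    intro Q₀ hQ₀ hQ₀' Q hQ hQ' A hA
    exact hstab.exists_paste (fun P hP => hP.1) hP₀ hσ hℱ hQ₀ hQ₀' hQ hQ' hA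
  obtain ⟨lo, hi, hlo, hhi, hmem⟩ := exists_essInf_essSup_mem_projKer hC hρ hP₀ hstabC ξ
  have hsub : {η' : BddMeas C | lo ≤ᵐ[P₀] η'.1 ∧ η'.1 ≤ᵐ[P₀] hi} ⊆ projKer hC ρ ξ := by
    obtain ⟨P, hP, -⟩ := hP₀.exists_equivalent
    exact fun η' h => hmem η' P hP ((hP₀.dominates P hP).ae_le h.1)
      ((hP₀.dominates P hP).ae_le h.2)
  have hker : ∀ η' ∈ projKer hC ρ ξ, ∃ P ∈ representingSet ρ, lo ≤ᵐ[P] η'.1 ∧ η'.1 ≤ᵐ[P] hi := by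
    intro η' h
    rw [projKer_eq_condExp hC hρ hcont ξ] at h
    obtain ⟨P, hP, hη⟩ := h
    exact ⟨P, hP, (hlo.lower P hP).trans_eq hη.symm, hη.trans_le (hhi.upper P hP)⟩
  refine ⟨lo, hi, hlo, hhi, hsub, Set.Subset.antisymm hker ?_, fun hequiv => ?_⟩
  · rintro η' ⟨P, hP, h₀, h₁⟩
    exact hmem η' P hP h₀ h₁
  · refine Set.Subset.antisymm (fun η' h => ?_) hsub
    obtain ⟨P, hP, h₀, h₁⟩ := hker η' h
    exact ⟨ae_le_of_trim_absolutelyContinuous hC (hequiv P hP) hlo.measurable η'.2.1 h₀,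
      ae_le_of_trim_absolutelyContinuous hC (hequiv P hP) η'.2.1 hhi.measurable h₁⟩
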